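/- **Setting.** An instance of stochastic $k$-TSP ($k\ge 1$ an integer) consists of a finite vertex set $V$ with $n=|V|$, a metric $d$ on $V$ (distinct vertices may be at distance $0$, but no other vertex is at distance $0$ from the depot), a depot $r\in V$, and known independent random rewards $R_v\in\{0,1,\dots,k\}$, $v\in V$. The value of $R_v$ is observed when $v$ is first visited. A policy is a finite decision tree whose nodes are vertices to visit and whose branches are observed rewards; it starts and ends at $r$, and it is feasible if almost surely it collects total reward at least $k$ or visits all vertices. $\mathrm{OPT}$ is the least expected length of a feasible policy. A non-adaptive policy is given by an ordered list of vertices, which are visited in this order until reward $k$ is collected or all vertices have been visited. A $\rho$-approximate orienteering oracle ($\rho\ge1$) gets profits $w:V\to\mathbb R_{\ge0}$ and a bound $B\ge 0$, and returns a tour from $r$ of length at most $B$ whose profit is at least $1/\rho$ times that of every tour from $r$ of length at most $B$. $H_k$ is the $k$-th harmonic number. **Algorithms.** *Ad-kTSP*: in phases $i=0,1,\dots$, repeat $\alpha$ times: let $S$ be the set of visited vertices and $k(\sigma)$ the reward observed; stop if $k(\sigma)\ge k$ or $S=V$; call the oracle with profits $w_v=\mathbb E[\min\{R_v,k-k(\sigma)\}]$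 for $v\notin S$, $w_v=0$ for $v\in S$, and bound $2^i$; traverse the tour obtained. *NonAd-kTSP*: in phases $i=0,1,\dots$, repeat $\alpha$ times: for $j=0,\dots,\lfloor\log_2k\rfloor$ append to the current list the tour returned by the oracle for profits $\mathbb E[\min\{R_v,k/2^j\}]$ for $v$ not yet in the list, $0$ otherwise, and bound $2^i$; the result is used as a non-adaptive policy. If $\sum_vR_v<k$ has positive probability, both algorithms are also given a tour $\tau$ through all vertices, of length at most twice that of every such tour, and in the first phase $i\ge1$ with $\mathrm{length}(\tau)\le 2^{i+1}$ they use $\tau$ in place of the tours returned by the oracle; if $\sum_v R_v\ge k$ almost surely, they may be run with or without such a $\tau$. **Theorem.** Suppose in (1)–(3) that all positive distances are at least $1$ (scaling) and that a $\rho$-approximate orienteering oracle is used. 1. For every integer $\alpha\ge 4\rho\frac{e}{e-1}H_k$, Ad-kTSP is feasible and has expected length at most $8\alpha\cdot\mathrm{OPT}$. 2. For every integer $\alpha\ge 8\rho\frac{e}{e-1}H_k$, NonAd-kTSP is feasible and has expected length at most $8\alpha\ell\cdot\mathrm{OPT}$, where $\ell=1+\lfloor\log_2k\rfloor$. In (1)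 and (2), if all distances from $r$ are at most the integer $D\ge 0$, then almost surely at most $N=\alpha\,(\lceil\log_2 D\rceil+\lceil\log_2 n\rceil+2)+n$ iterations are needed (with $\lceil\log_2 0\rceil:=0$): the bounds hold for the algorithms cut off after $N$ or more iterations. An iteration makes at most one oracle call in Ad-kTSP and at most $\ell$ in NonAd-kTSP. 3. There is an absolute constant $C$ such that, with $\alpha$ the least integer allowed, the expected lengths are at most $C\rho(1+\log k)\cdot\mathrm{OPT}$ for Ad-kTSP and $C\rho(1+\log k)^2\cdot\mathrm{OPT}$ for NonAd-kTSP. 4. There is an absolute constant $C$ such that for every instance (without any scaling, and without reference to an oracle) the least expected length of a feasible non-adaptive policy is at most $C(1+\log k)^2\cdot\mathrm{OPT}$; that is, the adaptivity gap is $O(\log^2k)$. -/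

import Mathlib

open scoped ENNReal

noncomputable section

/-- An instance of stochastic `k`-TSP on a finite vertex set `V`: a metric, a depot, and the
distributions of the rewards `R_v`, which are independent and supported on `{0, 1, …, k}`.
Vertices other than the depot may be co-located; in a genuine metric `depot_pos` is automatic. -/
structure KTSPInstance (V : Type*) (k : ℕ) where
  metric : PseudoMetricSpace V
  depot : V
  depot_pos : ∀ v, v ≠ depot → 0 < metric.dist depot v
  law : V → PMF (Fin (k + 1))

/-- Decision trees: an inner node is a vertex to be visited, and its branches correspond to the
reward observed there. -/
inductive DTree (V : Type*) (k : ℕ) where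
  | done : DTree V k
  | visit (v : V) (next : Fin (k + 1) → DTree V k) : DTree V k

/-- The vertices that a policy visits, in order, when the rewards are `x`. -/
def DTree.visits {V : Type*} {k : ℕ} : DTree V k → (V → Fin (k + 1)) → List V
  | .done, _ => []
  | .visit v next, x => v :: (next (x v)).visits x

namespace KTSPInstance

variable {V : Type*} {k : ℕ}

/-- The distance. -/
def d (I : KTSPInstance V k) (u v : V) : ℝ := I.metric.dist u v

/-- Length of the walk that starts at `u`, visits the vertices of the list in order and then
returns to the depot. -/
def walkLength (I : KTSPInstance V k) : V → List V → ℝ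
  | u, [] => I.d u I.depot
  | u, v :: l => I.d u v + I.walkLength v l

/-- Length of the closed tour depot, `l`, depot. A tour originating from the depot is given by
the list `l` of its later stops. -/
def tourLength (I : KTSPInstance V k) (l : List V) : ℝ := I.walkLength I.depot l

/-- The probability that the rewards are `x`. -/
def prob [Fintype V] (I : KTSPInstance V k) (x : V → Fin (k + 1)) : ℝ≥0∞ :=
  ∏ v, I.law v (x v)

/-- The expected length of a policy, including the return to the depot. -/
def cost [Fintype V] [DecidableEq V] (I : KTSPInstance V k) (T : DTree V k) : ℝ≥0∞ :=
  ∑ x : V → Fin (k + 1), I.prob x * ENNReal.ofReal (I.tourLength (T.visits x))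

/-- A policy is feasible if almost surely it collects reward at least `k` or visits all vertices.
The reward of a vertex is collected once, however often the vertex is visited. -/
def Feasible [Fintype V] [DecidableEq V] (I : KTSPInstance V k) (T : DTree V k) : Prop :=
  ∀ x : V → Fin (k + 1), I.prob x ≠ 0 →
    k ≤ ∑ v ∈ (T.visits x).toFinset, (x v : ℕ) ∨ (T.visits x).toFinset = Finset.univ

/-- The optimal expected length over all adaptive policies. -/
def opt [Fintype V] [DecidableEq V] (I : KTSPInstance V k) : ℝ≥0∞ :=
  ⨅ (T : DTree V k) (_ : I.Feasible T), I.cost T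

/-- The non-adaptive policy of an ordered list, when the vertices in `S` have been visited with
total reward `a`: visit the vertices in the given order until the target is met or all vertices
have been visited. -/
def listPolicyFrom [Fintype V] [DecidableEq V] : List V → Finset V → ℕ → DTree V k
  | [], _, _ => .done
  | v :: l, S, a =>
    if k ≤ a ∨ S = Finset.univ then .done
    else .visit v fun j => listPolicyFrom l (insert v S) (if v ∈ S then a else a + j)

/-- The non-adaptive policy of an ordered list of vertices. -/
def listPolicy [Fintype V] [DecidableEq V] (k : ℕ) (l : List V) : DTree V k :=
  listPolicyFrom l ∅ 0

/-- The optimal expected length over all non-adaptive policies. -/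
def nonAdaptiveOpt [Fintype V] [DecidableEq V] (I : KTSPInstance V k) : ℝ≥0∞ :=
  ⨅ (l : List V) (_ : I.Feasible (listPolicy k l)), I.cost (listPolicy k l)

/-- The total profit of the tour depot, `l`, depot; the profit of a vertex counts once. -/
def profit [DecidableEq V] (I : KTSPInstance V k) (w : V → ℝ) (l : List V) : ℝ :=
  ∑ v ∈ (I.depot :: l).toFinset, w v

/-- `O` is a `ρ`-approximation algorithm for orienteering on the given metric and depot: for
profits `w` and length bound `B`, `O w B` is a tour of length at most `B` whose profit is at least
`1 / ρ` times the profit of every tour of length at most `B`. -/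
def IsOrienteeringOracle [DecidableEq V] (I : KTSPInstance V k) (ρ : ℝ)
    (O : (V → ℝ) → ℝ → List V) : Prop :=
  ∀ (w : V → ℝ) (B : ℝ), (∀ v, 0 ≤ w v) → 0 ≤ B →
    I.tourLength (O w B) ≤ B ∧
      ∀ l : List V, I.tourLength l ≤ B → I.profit w l ≤ ρ * I.profit w (O w B)

/-- Truncated expectations `E[min (R_v, c)]` as profits, zero on the set `S`. -/
def truncProfit [DecidableEq V] (I : KTSPInstance V k) (c : ℝ) (S : Finset V) (v : V) : ℝ :=
  if v ∈ S then 0 else ∑ j : Fin (k + 1), (I.law v j).toReal * min (j : ℝ) c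

/-- The tour used in phase `i`, given the tour `π` from the orienteering subroutine. For
`τ = none` it is always `π`. If `τ` is a tour, then this tour is used instead as soon as `1 ≤ i`
and its length is at most `2 ^ (i + 1)`. -/
def phaseTour (I : KTSPInstance V k) (τ : Option (List V)) (i : ℕ) (π : List V) : List V :=
  match τ with
  | none => π
  | some l => if 1 ≤ i ∧ I.tourLength l ≤ 2 ^ (i + 1) then l else π

/-- Visit the vertices of a list one after the other, whatever is observed, and then go on with
the policy `next S a`, where `S` is the set of vertices visited so far and `a` their total
reward. -/
def traverse [DecidableEq V] :
    List V → Finset V → ℕ → (Finset V → ℕ → DTree V k) → DTree V k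
  | [], S, a, next => next S a
  | v :: l, S, a, next =>
    .visit v fun j => traverse l (insert v S) (if v ∈ S then a else a + j) next

/-- Algorithm Ad-kTSP from iteration `m` on, in the state with visited vertices `S` and observed
reward `a`. Each phase has `α` iterations, so iteration `m` belongs to phase `m / α`. The first
argument bounds the number of iterations that are carried out, hence that of oracle calls. -/
def adKTSPFrom [Fintype V] [DecidableEq V] (I : KTSPInstance V k) (O : (V → ℝ) → ℝ → List V)
    (τ : Option (List V)) (α : ℕ) : ℕ → ℕ → Finset V → ℕ → DTree V k
  | 0, _, _, _ => .done
  | N + 1, m, S, a =>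
    if k ≤ a ∨ S = Finset.univ then .done
    else
      traverse
        (I.depot ::
          I.phaseTour τ (m / α) (O (I.truncProfit ((k : ℝ) - a) S) (2 ^ (m / α))))
        S a (fun S' a' => adKTSPFrom I O τ α N (m + 1) S' a')

/-- Algorithm Ad-kTSP, cut off after `N` iterations. -/
def adKTSP [Fintype V] [DecidableEq V] (I : KTSPInstance V k) (O : (V → ℝ) → ℝ → List V)
    (τ : Option (List V)) (α N : ℕ) : DTree V k :=
  adKTSPFrom I O τ α N 0 ∅ 0

/-- The first iterations `j = 0, 1, …` of the inner loop of NonAd-kTSP in phase `i`, started with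
the current tour `t`. -/
def nonAdInner [DecidableEq V] (I : KTSPInstance V k) (O : (V → ℝ) → ℝ → List V)
    (i : ℕ) (t : List V) : ℕ → List V
  | 0 => t
  | j + 1 =>
    let s := I.nonAdInner O i t j
    s ++ I.depot :: O (I.truncProfit ((k : ℝ) / 2 ^ j) s.toFinset) (2 ^ i)

/-- The tour that algorithm NonAd-kTSP has built after the given number of iterations of its
middle loop. There are `α` of these in each phase, and each of them runs the inner loop for
`j = 0, …, ⌊log₂ k⌋`, unless the tour `τ` is used (see `phaseTour`). -/
def nonAdTour [DecidableEq V] (I : KTSPInstance V k) (O : (V → ℝ) → ℝ → List V)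
    (τ : Option (List V)) (α : ℕ) : ℕ → List V
  | 0 => []
  | m + 1 =>
    let t := I.nonAdTour O τ α m
    match τ with
    | none => I.nonAdInner O (m / α) t (1 + Nat.log 2 k)
    | some l =>
      if 1 ≤ m / α ∧ I.tourLength l ≤ 2 ^ (m / α + 1) then t ++ I.depot :: l
      else I.nonAdInner O (m / α) t (1 + Nat.log 2 k)

/-- Algorithm NonAd-kTSP, cut off after `N` iterations of its middle loop. -/
def nonAdKTSP [Fintype V] [DecidableEq V] (I : KTSPInstance V k) (O : (V → ℝ) → ℝ → List V)
    (τ : Option (List V)) (α N : ℕ) : DTree V k :=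
  listPolicy k (I.nonAdTour O τ α N)

/-- The algorithms as such (`τ = none`) are run on instances whose total reward is almost surely
at least `k`. On an arbitrary instance they are given a tour through all vertices that is at most
twice as long as any other such tour (for example from a doubled spanning tree). -/
def CompletionRule [Fintype V] [DecidableEq V] (I : KTSPInstance V k) :
    Option (List V) → Prop
  | none => ∀ x : V → Fin (k + 1), I.prob x ≠ 0 → k ≤ ∑ v, (x v : ℕ)
  | some τ => (∀ v, v ∈ I.depot :: τ) ∧
      ∀ l : List V, (∀ v, v ∈ I.depot :: l) → I.tourLength τ ≤ 2 * I.tourLength l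

/-- All positive distances are at least one. -/
def Normalized (I : KTSPInstance V k) : Prop := ∀ u v, 0 < I.d u v → 1 ≤ I.d u v

end KTSPInstance

/-- `c · ρ · (e / (e - 1)) · H_k`. -/
def iterBound (c ρ : ℝ) (k : ℕ) : ℝ :=
  c * ρ * (Real.exp 1 / (Real.exp 1 - 1)) * (harmonic k : ℝ)

/-- Number of iterations that suffice when all vertices are within distance `D` of the depot. -/
def callBound (α n D : ℕ) : ℕ := α * (Nat.clog 2 D + Nat.clog 2 n + 2) + n

end

/-! Both algorithms are compared, phase by phase, with an arbitrary feasible policy `T`. Let r be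
the residual target at some history and p the conditional probability that `T` has length at most b
= 2^i. Cut `T` off so that it always returns within b. Whether it visits v is independent of the
reward of v, so its expected collected profit equals the expected profit of its tour, and some tour
of length at most b has profit at least r·p (`expect_short_mul_le`). The oracle loses ρ, and passing
from the sum of truncated means to the mean of the truncated sum loses 1 - 1/e
(`le_expect_min_sum`). So one iteration has expected capped gain at least (1 - 1/e)·r·p/ρ
(`oracle_gain`).

Relative progress is measured by the harmonic number of the residual target: gaining g lowers it by
at least min(g, r)/r (`min_div_le_harmonic_sub`), and it can fall by at most H_k in total. Let U_i
be the probability of being unfinished before phase i and L_i that of `T` being longer than 2^i.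
Telescoping over α iterations gives U_{i+1} ≤ U_i/4 + L_i (`expect_unfinished_le`). Weighting by 2^i
and summing gives 8α times the expected length of `T` (`expect_length_le`).

The non-adaptive list does not know r. One of the caps k/2^j lies between r and 2r, and its tour
still gains half as much, even without knowledge of the rewards listed earlier in the round
(`oracle_gain_of_cap`). The ℓ caps add the factor ℓ to the length. `T` remains adaptive in this
comparison, so exact oracles and rescaling yield the adaptivity gap.

For feasibility, once the bound admits a tour through all vertices, either the completion tour is
used or each unfinished iteration reaches a new vertex (`oracle_not_subset`,
`Exploration.finished_of_growth`). -/

noncomputable section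

/-! ### Expectation, independence and resampling on the product space -/

namespace KTSPInstance

variable {V : Type*} {k : ℕ}

/-- The probability of the reward `j` at `v`, as a real number. -/
def mass (I : KTSPInstance V k) (v : V) (j : Fin (k + 1)) : ℝ := (I.law v j).toReal

theorem mass_nonneg (I : KTSPInstance V k) (v : V) (j : Fin (k + 1)) : 0 ≤ I.mass v j :=
  ENNReal.toReal_nonneg

theorem sum_mass (I : KTSPInstance V k) (v : V) : ∑ j, I.mass v j = 1 := by
  unfold mass
  rw [← ENNReal.toReal_sum fun j _ => (I.law v).apply_ne_top j, ← tsum_fintype (L := .unconditional _),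
    (I.law v).tsum_coe, ENNReal.toReal_one]

/-- The total reward of a set of vertices. -/
def reward (S : Finset V) (x : V → Fin (k + 1)) : ℕ := ∑ v ∈ S, (x v : ℕ)

theorem reward_congr {S : Finset V} {x y : V → Fin (k + 1)} (h : ∀ v ∈ S, x v = y v) :
    reward S x = reward S y :=
  Finset.sum_congr rfl fun v hv => by rw [h v hv]

variable [Fintype V]

/-- The probability of a reward vector, as a real number. -/
def weight (I : KTSPInstance V k) (x : V → Fin (k + 1)) : ℝ := ∏ v, I.mass v (x v)

theorem weight_nonneg (I : KTSPInstance V k) (x : V → Fin (k + 1)) : 0 ≤ I.weight x :=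
  Finset.prod_nonneg fun v _ => I.mass_nonneg v _

theorem toReal_prob (I : KTSPInstance V k) (x : V → Fin (k + 1)) :
    (I.prob x).toReal = I.weight x := by
  simp [prob, weight, mass, ENNReal.toReal_prod]

theorem prob_ne_top (I : KTSPInstance V k) (x : V → Fin (k + 1)) : I.prob x ≠ ⊤ :=
  ENNReal.prod_ne_top fun v _ => (I.law v).apply_ne_top _

theorem prob_ne_zero_iff (I : KTSPInstance V k) (x : V → Fin (k + 1)) :
    I.prob x ≠ 0 ↔ ∀ v, I.law v (x v) ≠ 0 := by
  simp [prob, Finset.prod_ne_zero_iff]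

theorem weight_eq_zero (I : KTSPInstance V k) {x : V → Fin (k + 1)} (h : I.prob x = 0) :
    I.weight x = 0 := by
  rw [← toReal_prob, h, ENNReal.toReal_zero]

variable [DecidableEq V]

theorem prob_piecewise_ne_zero (I : KTSPInstance V k) {x y : V → Fin (k + 1)} (S : Finset V)
    (hx : I.prob x ≠ 0) (hy : I.prob y ≠ 0) : I.prob (S.piecewise x y) ≠ 0 := by
  rw [prob_ne_zero_iff] at *
  intro v
  by_cases hv : v ∈ S <;> simp [hv, hx v, hy v]

/-- The expectation of a function of the rewards. -/
def expect (I : KTSPInstance V k) (f : (V → Fin (k + 1)) → ℝ) : ℝ := ∑ x, I.weight x * f x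

theorem expect_mono (I : KTSPInstance V k) {f g : (V → Fin (k + 1)) → ℝ}
    (h : ∀ x, I.prob x ≠ 0 → f x ≤ g x) : I.expect f ≤ I.expect g := by
  refine Finset.sum_le_sum fun x _ => ?_
  by_cases hx : I.prob x = 0
  · simp [I.weight_eq_zero hx]
  · exact mul_le_mul_of_nonneg_left (h x hx) (I.weight_nonneg x)

theorem expect_add (I : KTSPInstance V k) (f g : (V → Fin (k + 1)) → ℝ) :
    I.expect (fun x => f x + g x) = I.expect f + I.expect g := by
  simp [expect, mul_add, Finset.sum_add_distrib]

theorem expect_sub (I : KTSPInstance V k) (f g : (V → Fin (k + 1)) → ℝ) :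
    I.expect (fun x => f x - g x) = I.expect f - I.expect g := by
  simp [expect, mul_sub, Finset.sum_sub_distrib]

theorem expect_const_mul (I : KTSPInstance V k) (c : ℝ) (f : (V → Fin (k + 1)) → ℝ) :
    I.expect (fun x => c * f x) = c * I.expect f := by
  simp only [expect, Finset.mul_sum]
  exact Finset.sum_congr rfl fun x _ => by ring

theorem expect_sum {ι : Type*} (I : KTSPInstance V k) (s : Finset ι)
    (f : ι → (V → Fin (k + 1)) → ℝ) :
    I.expect (fun x => ∑ i ∈ s, f i x) = ∑ i ∈ s, I.expect (f i) := by
  simp only [expect, Finset.mul_sum]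
  exact Finset.sum_comm

theorem expect_prod (I : KTSPInstance V k) (g : V → Fin (k + 1) → ℝ) :
    I.expect (fun x => ∏ v, g v (x v)) = ∏ v, ∑ j, I.mass v j * g v j := by
  simp only [expect, weight, ← Finset.prod_mul_distrib]
  rw [Finset.prod_univ_sum, Fintype.piFinset_univ]

theorem expect_one (I : KTSPInstance V k) : I.expect (fun _ => 1) = 1 := by
  simpa [sum_mass] using I.expect_prod (fun _ _ => 1)

theorem expect_const (I : KTSPInstance V k) (c : ℝ) : I.expect (fun _ => c) = c := by
  simpa [expect_one] using I.expect_const_mul c (fun _ => 1)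

theorem expect_nonneg (I : KTSPInstance V k) {f : (V → Fin (k + 1)) → ℝ} (h : ∀ x, 0 ≤ f x) :
    0 ≤ I.expect f :=
  Finset.sum_nonneg fun x _ => mul_nonneg (I.weight_nonneg x) (h x)

theorem expect_prod_finset (I : KTSPInstance V k) (B : Finset V) (g : V → Fin (k + 1) → ℝ) :
    I.expect (fun x => ∏ v ∈ B, g v (x v)) = ∏ v ∈ B, ∑ j, I.mass v j * g v j := by
  have h := I.expect_prod (fun v j => if v ∈ B then g v j else 1)
  have h2 : ∀ v, (∑ j, I.mass v j * if v ∈ B then g v j else 1) =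
      if v ∈ B then ∑ j, I.mass v j * g v j else 1 := by
    intro v
    split_ifs <;> simp [sum_mass]
  simp only [h2, Finset.prod_ite_mem, Finset.univ_inter] at h
  exact h

theorem expect_apply (I : KTSPInstance V k) (v : V) (g : Fin (k + 1) → ℝ) :
    I.expect (fun x => g (x v)) = ∑ j, I.mass v j * g j := by
  simpa using I.expect_prod_finset {v} (fun _ => g)

/-- Resampling the rewards outside a fixed set of vertices. -/
theorem expect_resample (I : KTSPInstance V k) (S : Finset V) (f : (V → Fin (k + 1)) → ℝ) :
    I.expect f = I.expect fun x => I.expect fun y => f (S.piecewise x y) := by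
  -- `σ` exchanges the coordinates outside `S` between two independent copies. It is an involution
  -- that preserves the product of the two weights.
  let σ : (V → Fin (k + 1)) × (V → Fin (k + 1)) → (V → Fin (k + 1)) × (V → Fin (k + 1)) :=
    fun p => (S.piecewise p.1 p.2, S.piecewise p.2 p.1)
  have hσ : Function.Involutive σ := by
    rintro ⟨x, y⟩
    ext v <;> by_cases hv : v ∈ S <;> simp [σ, hv]
  have h1 : I.expect f = ∑ p : (V → Fin (k + 1)) × (V → Fin (k + 1)),
      I.weight p.1 * I.weight p.2 * f p.1 := by
    rw [Fintype.sum_prod_type]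
    refine Finset.sum_congr rfl fun x _ => ?_
    have := I.expect_const (I.weight x * f x)
    simp only [expect] at this
    rw [← this]
    exact Finset.sum_congr rfl fun y _ => by ring
  rw [h1, ← Equiv.sum_comp hσ.toPerm, Fintype.sum_prod_type]
  refine Finset.sum_congr rfl fun x _ => ?_
  simp only [expect, Finset.mul_sum]
  refine Finset.sum_congr rfl fun y _ => ?_
  have : I.weight (S.piecewise x y) * I.weight (S.piecewise y x) = I.weight x * I.weight y := by
    simp only [weight, ← Finset.prod_mul_distrib]
    refine Finset.prod_congr rfl fun v _ => ?_
    by_cases hv : v ∈ S <;> simp [hv, mul_comm]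
  simp only [Function.Involutive.coe_toPerm, σ, this]
  ring

/-- Resampling the rewards outside a random set that is determined by the rewards in it. -/
theorem expect_resample_stopping (I : KTSPInstance V k) (S : (V → Fin (k + 1)) → Finset V)
    (hS : ∀ x z, (∀ v ∈ S x, x v = z v) → S x = S z) (f : (V → Fin (k + 1)) → ℝ) :
    I.expect f = I.expect fun x => I.expect fun y => f ((S x).piecewise x y) := by
  have hsplit : ∀ g : (V → Fin (k + 1)) → ℝ,
      I.expect g = ∑ A : Finset V, I.expect fun x => if S x = A then g x else 0 := by
    intro g
    rw [← expect_sum]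
    simp
  -- Split by the value `A` of the random set. The event `S x = A` depends on the rewards in `A`
  -- only, so it survives resampling outside `A`.
  rw [hsplit f, hsplit]
  refine Finset.sum_congr rfl fun A _ => ?_
  rw [I.expect_resample A]
  congr 1
  ext x
  by_cases hx : S x = A
  · have h : ∀ y, S (A.piecewise x y) = A := fun y => by
      rw [← hx]
      exact (hS _ _ fun v hv => by simp [hv]).symm
    subst hx
    simp [h]
  · have h : ∀ y, S (A.piecewise x y) ≠ A := fun y hy => hx <| by
      have := hS (A.piecewise x y) x fun v hv => by
        rw [hy] at hv
        simp [hv]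
      rw [← this, hy]
    simp [h, hx, expect_const]

/-- A function that does not depend on the reward of `v` is independent of that reward. -/
theorem expect_mul_apply (I : KTSPInstance V k) (v : V) (f : (V → Fin (k + 1)) → ℝ)
    (hf : ∀ y j, f (Function.update y v j) = f y) (g : Fin (k + 1) → ℝ) :
    I.expect (fun x => f x * g (x v)) = I.expect f * I.expect fun x => g (x v) := by
  rw [I.expect_resample {v}]
  have h : ∀ x y : V → Fin (k + 1), f (({v} : Finset V).piecewise x y) *
      g (({v} : Finset V).piecewise x y v) = g (x v) * f y := by
    intro x y
    rw [Finset.piecewise_singleton, hf, Function.update_self, mul_comm]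
  simp only [h, expect_const_mul]
  rw [← expect_const_mul]
  congr 1
  ext x
  ring

theorem cost_eq (I : KTSPInstance V k) (T : DTree V k)
    (h : ∀ x, 0 ≤ I.tourLength (T.visits x)) :
    I.cost T = ENNReal.ofReal (I.expect fun x => I.tourLength (T.visits x)) := by
  unfold cost expect
  rw [ENNReal.ofReal_sum_of_nonneg fun x _ => mul_nonneg (I.weight_nonneg x) (h x)]
  refine Finset.sum_congr rfl fun x _ => ?_
  rw [ENNReal.ofReal_mul (I.weight_nonneg x), ← toReal_prob,
    ENNReal.ofReal_toReal (I.prob_ne_top x)]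

end KTSPInstance
end

/-! ### The expected gain of a single oracle tour -/

noncomputable section

/-- A union bound. Applied pointwise to normalized truncated rewards, it replaces their sum by an
expression whose expectation factors. -/
theorem one_sub_prod_one_sub_le_sum {ι : Type*} (s : Finset ι) (f : ι → ℝ)
    (h0 : ∀ i ∈ s, 0 ≤ f i) (h1 : ∀ i ∈ s, f i ≤ 1) :
    1 - ∏ i ∈ s, (1 - f i) ≤ ∑ i ∈ s, f i := by
  classical
  induction s using Finset.induction_on with
  | empty => simp
  | insert a s ha ih =>
    rw [Finset.prod_insert ha, Finset.sum_insert ha]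
    have ih' := ih (fun i hi => h0 i (Finset.mem_insert_of_mem hi))
      fun i hi => h1 i (Finset.mem_insert_of_mem hi)
    have hp : ∏ i ∈ s, (1 - f i) ≤ 1 := Finset.prod_le_one
      (fun i hi => sub_nonneg.2 (h1 i (Finset.mem_insert_of_mem hi)))
      fun i hi => sub_le_self _ (h0 i (Finset.mem_insert_of_mem hi))
    nlinarith [h0 a (Finset.mem_insert_self a s)]

/-- The constant `1 - 1 / e`. -/
def greedyConst : ℝ := 1 - Real.exp (-1)

theorem greedyConst_pos : 0 < greedyConst := by
  have : Real.exp (-1) < 1 := by rw [← Real.exp_zero]; exact Real.exp_lt_exp.2 (by norm_num)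
  unfold greedyConst
  linarith

theorem greedyConst_lt_one : greedyConst < 1 := by
  have := Real.exp_pos (-1)
  unfold greedyConst
  linarith

theorem greedyConst_eq : greedyConst = (Real.exp 1 / (Real.exp 1 - 1))⁻¹ := by
  have h : (1 : ℝ) < Real.exp 1 := Real.one_lt_exp_iff.2 one_pos
  rw [greedyConst, Real.exp_neg, inv_div]
  field_simp

/-- By convexity, `exp` lies below its chord over [-1, 0]. -/
theorem exp_neg_le_one_sub_greedyConst_mul {t : ℝ} (h0 : 0 ≤ t) (h1 : t ≤ 1) :
    Real.exp (-t) ≤ 1 - greedyConst * t := by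
  have := convexOn_exp.2 (Set.mem_univ (0 : ℝ)) (Set.mem_univ (-1 : ℝ)) (sub_nonneg.2 h1) h0
    (by ring)
  simp only [smul_eq_mul, mul_zero, Real.exp_zero] at this
  calc Real.exp (-t) = Real.exp (0 + t * -1) := by congr 1; ring
    _ ≤ _ := this
    _ = _ := by unfold greedyConst; ring

namespace KTSPInstance

variable {V : Type*} {k : ℕ}

theorem truncProfit_of_notMem [DecidableEq V] (I : KTSPInstance V k) (c : ℝ) {S : Finset V} {v : V}
    (h : v ∉ S) : I.truncProfit c S v = ∑ j, I.mass v j * min (j : ℝ) c := by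
  simp [truncProfit, h, mass]

theorem truncProfit_nonneg [DecidableEq V] (I : KTSPInstance V k) {c : ℝ} (hc : 0 ≤ c)
    (S : Finset V) (v : V) : 0 ≤ I.truncProfit c S v := by
  unfold truncProfit
  split_ifs
  · exact le_rfl
  · exact Finset.sum_nonneg fun j _ => mul_nonneg (I.mass_nonneg v j) (le_min (by positivity) hc)

theorem profit_truncProfit [DecidableEq V] (I : KTSPInstance V k) (c : ℝ) (S : Finset V)
    (l : List V) : I.profit (I.truncProfit c S) l =
      ∑ v ∈ (I.depot :: l).toFinset \ S, ∑ j, I.mass v j * min (j : ℝ) c := by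
  unfold profit
  rw [← Finset.sum_subset (Finset.sdiff_subset (t := S))]
  · refine Finset.sum_congr rfl fun v hv => ?_
    rw [I.truncProfit_of_notMem c (Finset.mem_sdiff.1 hv).2]
  · intro v hv hv'
    have : v ∈ S := by
      by_contra h
      exact hv' (Finset.mem_sdiff.2 ⟨hv, h⟩)
    simp [truncProfit, this]

/-- A sum of independent truncated rewards, truncated again, has a large expectation. -/
theorem le_expect_min_sum [Fintype V] [DecidableEq V] (I : KTSPInstance V k) (B : Finset V) {c : ℝ}
    (hc : 0 < c) :
    greedyConst * min c (∑ v ∈ B, ∑ j, I.mass v j * min (j : ℝ) c) ≤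
      I.expect fun y => min (∑ v ∈ B, (y v : ℝ)) c := by
  set μ : V → ℝ := fun v => ∑ j, I.mass v j * (min (j : ℝ) c / c) with hμ
  have hX0 : ∀ j : Fin (k + 1), 0 ≤ min (j : ℝ) c / c := fun j => by positivity
  have hX1 : ∀ j : Fin (k + 1), min (j : ℝ) c / c ≤ 1 := fun j =>
    (div_le_one hc).2 (min_le_right _ _)
  have hμ0 : ∀ v, 0 ≤ μ v := fun v =>
    Finset.sum_nonneg fun j _ => mul_nonneg (I.mass_nonneg v j) (hX0 j)
  have hμ1 : ∀ v, μ v ≤ 1 := fun v => by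
    rw [← I.sum_mass v]
    exact Finset.sum_le_sum fun j _ => mul_le_of_le_one_right (I.mass_nonneg v j) (hX1 j)
  have hW : ∑ v ∈ B, ∑ j, I.mass v j * min (j : ℝ) c = c * ∑ v ∈ B, μ v := by
    rw [hμ, Finset.mul_sum]
    refine Finset.sum_congr rfl fun v _ => ?_
    rw [Finset.mul_sum]
    refine Finset.sum_congr rfl fun j _ => ?_
    field_simp
  -- This is where independence enters; the rest of the bound is pointwise or numerical.
  have hprod : I.expect (fun y => ∏ v ∈ B, (1 - min (y v : ℝ) c / c)) = ∏ v ∈ B, (1 - μ v) := by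
    rw [I.expect_prod_finset B fun _ j => 1 - min (j : ℝ) c / c]
    refine Finset.prod_congr rfl fun v _ => ?_
    simp [mul_sub, Finset.sum_sub_distrib, sum_mass, hμ]
  have hsum0 : 0 ≤ ∑ v ∈ B, μ v := Finset.sum_nonneg fun v _ => hμ0 v
  have hbound : ∏ v ∈ B, (1 - μ v) ≤ 1 - greedyConst * min 1 (∑ v ∈ B, μ v) := calc
    ∏ v ∈ B, (1 - μ v) ≤ ∏ v ∈ B, Real.exp (-μ v) :=
      Finset.prod_le_prod (fun v _ => sub_nonneg.2 (hμ1 v)) fun v _ => Real.one_sub_le_exp_neg _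
    _ = Real.exp (-∑ v ∈ B, μ v) := by rw [← Real.exp_sum, Finset.sum_neg_distrib]
    _ ≤ Real.exp (-min 1 (∑ v ∈ B, μ v)) := Real.exp_le_exp.2 (neg_le_neg (min_le_right _ _))
    _ ≤ _ := exp_neg_le_one_sub_greedyConst_mul (le_min zero_le_one hsum0) (min_le_left _ _)
  calc greedyConst * min c (∑ v ∈ B, ∑ j, I.mass v j * min (j : ℝ) c)
      = c * (greedyConst * min 1 (∑ v ∈ B, μ v)) := by
        rw [hW, mul_left_comm, mul_min_of_nonneg _ _ hc.le, mul_one]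
    _ ≤ c * (1 - ∏ v ∈ B, (1 - μ v)) := by
        refine mul_le_mul_of_nonneg_left ?_ hc.le
        linarith
    _ = I.expect fun y => c * (1 - ∏ v ∈ B, (1 - min (y v : ℝ) c / c)) := by
        rw [expect_const_mul, expect_sub, expect_one, hprod]
    _ ≤ _ := by
        refine I.expect_mono fun y _ => le_min ?_ ?_
        · calc c * (1 - ∏ v ∈ B, (1 - min (y v : ℝ) c / c))
              ≤ c * ∑ v ∈ B, min (y v : ℝ) c / c := mul_le_mul_of_nonneg_left
                (one_sub_prod_one_sub_le_sum B _ (fun v _ => hX0 (y v)) fun v _ => hX1 (y v)) hc.le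
            _ = ∑ v ∈ B, min (y v : ℝ) c := by
                rw [Finset.mul_sum]
                exact Finset.sum_congr rfl fun v _ => mul_div_cancel₀ _ hc.ne'
            _ ≤ _ := Finset.sum_le_sum fun v _ => min_le_left _ _
        · refine mul_le_of_le_one_right hc.le (sub_le_self _ ?_)
          exact Finset.prod_nonneg fun v _ => sub_nonneg.2 (hX1 (y v))

theorem d_nonneg (I : KTSPInstance V k) (u v : V) : 0 ≤ I.d u v :=
  @dist_nonneg V I.metric u v

theorem d_self (I : KTSPInstance V k) (u : V) : I.d u u = 0 := @dist_self V I.metric u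

theorem d_comm (I : KTSPInstance V k) (u v : V) : I.d u v = I.d v u := @dist_comm V I.metric u v

theorem d_triangle (I : KTSPInstance V k) (u v w : V) : I.d u w ≤ I.d u v + I.d v w :=
  @dist_triangle V I.metric u v w

theorem d_depot_le_walkLength (I : KTSPInstance V k) (u : V) (l : List V) :
    I.d u I.depot ≤ I.walkLength u l := by
  induction l generalizing u with
  | nil => exact le_rfl
  | cons v l ih => exact (I.d_triangle u v _).trans (add_le_add_right (ih v) _)

theorem tourLength_nonneg (I : KTSPInstance V k) (l : List V) : 0 ≤ I.tourLength l :=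
  (I.d_nonneg _ _).trans (I.d_depot_le_walkLength _ l)

/-- The part of a policy that can be carried out on a walk from `u` to the depot of length at
most `b`. -/
def truncate (I : KTSPInstance V k) :
    DTree V k → V → ℝ → DTree V k
  | .done, _, _ => .done
  | .visit v next, u, b =>
    if I.d u v + I.d v I.depot ≤ b then
      .visit v fun j => I.truncate (next j) v (b - I.d u v)
    else .done

theorem walkLength_truncate_le (I : KTSPInstance V k)
    (x : V → Fin (k + 1)) (T : DTree V k) (u : V) (b : ℝ) (hb : I.d u I.depot ≤ b) :
    I.walkLength u ((I.truncate T u b).visits x) ≤ b := by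
  induction T generalizing u b with
  | done => exact hb
  | visit v next ih =>
    unfold truncate
    split_ifs with h
    · have := ih (x v) v (b - I.d u v) (by linarith)
      simp only [DTree.visits, walkLength]
      linarith
    · exact hb

/-- The rest of a walk from v is at least as long as the direct return from v, so a walk that fits
into the budget passes every test. -/
theorem visits_truncate (I : KTSPInstance V k)
    (x : V → Fin (k + 1)) (T : DTree V k) (u : V) (b : ℝ)
    (hb : I.walkLength u (T.visits x) ≤ b) : (I.truncate T u b).visits x = T.visits x := by
  induction T generalizing u b with
  | done => rfl
  | visit v next ih =>
    simp only [DTree.visits, walkLength] at hb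
    have := I.d_depot_le_walkLength v ((next (x v)).visits x)
    rw [truncate, if_pos (by linarith)]
    simp only [DTree.visits]
    rw [ih (x v) v _ (by linarith)]

end KTSPInstance

/-- The reward of v is observed only once v is reached, too late to influence whether v is visited.
This is the source of independence for adaptive policies. -/
theorem DTree.mem_visits_update {V : Type*} [DecidableEq V] {k : ℕ} (T : DTree V k) (v : V)
    (x : V → Fin (k + 1)) (j : Fin (k + 1)) :
    v ∈ T.visits (Function.update x v j) ↔ v ∈ T.visits x := by
  induction T with
  | done => rfl
  | visit u next ih =>
    by_cases h : v = u
    · simp [DTree.visits, h]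
    · have h' : u ≠ v := fun h' => h h'.symm
      simp [DTree.visits, h, Function.update_of_ne h', ih]

namespace KTSPInstance

variable {V : Type*} {k : ℕ} [Fintype V] [DecidableEq V]

/-- The expected truncated reward that a policy collects outside `S`, given the rewards in `S`,
is the expected profit of its tour. -/
theorem expect_sum_visits (I : KTSPInstance V k) (T : DTree V k) (S : Finset V)
    (x : V → Fin (k + 1)) (c : ℝ) :
    I.expect (fun y => ∑ v ∈ (T.visits (S.piecewise x y)).toFinset \ S, min (y v : ℝ) c) =
      I.expect fun y => ∑ v ∈ (T.visits (S.piecewise x y)).toFinset \ S,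
        ∑ j, I.mass v j * min (j : ℝ) c := by
  have key : ∀ g : V → (V → Fin (k + 1)) → ℝ,
      I.expect (fun y => ∑ v ∈ (T.visits (S.piecewise x y)).toFinset \ S, g v y) =
        ∑ v ∈ Sᶜ, I.expect fun y => (if v ∈ T.visits (S.piecewise x y) then 1 else 0) * g v y := by
    intro g
    rw [← expect_sum]
    congr 1
    ext y
    simp only [ite_mul, one_mul, zero_mul]
    rw [← Finset.sum_filter]
    refine Finset.sum_congr ?_ fun _ _ => rfl
    ext v
    simp [and_comm]
  rw [key, key]
  refine Finset.sum_congr rfl fun v hv => ?_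
  have hv' : v ∉ S := Finset.mem_compl.1 hv
  rw [I.expect_mul_apply v _ _ fun j => min (j : ℝ) c, I.expect_apply v fun j => min (j : ℝ) c]
  · simp_rw [mul_comm _ (∑ j, I.mass v j * min (j : ℝ) c)]
    rw [expect_const_mul]
  · intro y j
    have : S.piecewise x (Function.update y v j) = Function.update (S.piecewise x y) v j := by
      ext u
      by_cases hu : u = v
      · subst hu; simp [hv']
      · by_cases huS : u ∈ S <;> simp [huS, hu]
    simp only [this, DTree.mem_visits_update]

/-- A policy that is likely to meet the target within length `b` yields a tour of length at most
`b` and large profit. -/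
theorem expect_short_mul_le (I : KTSPInstance V k) (T : DTree V k) (S : Finset V)
    {x : V → Fin (k + 1)} (hx : I.prob x ≠ 0) {b c r W : ℝ} (hb : 0 ≤ b)
    (hr : r ≤ k - reward S x) (hr0 : 0 ≤ r) (hrc : r ≤ c)
    (hT : ∀ z, I.prob z ≠ 0 → I.tourLength (T.visits z) ≤ b →
      k ≤ reward (T.visits z).toFinset z)
    (hW : ∀ l, I.tourLength l ≤ b → I.profit (I.truncProfit c S) l ≤ W) :
    r * I.expect (fun y => if I.tourLength (T.visits (S.piecewise x y)) ≤ b then 1 else 0) ≤ W := by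
  classical
  rw [← expect_const_mul]
  set T' := I.truncate T I.depot b
  have hc0 : 0 ≤ c := hr0.trans hrc
  calc _ ≤ I.expect (fun y => ∑ v ∈ (T'.visits (S.piecewise x y)).toFinset \ S,
        min (y v : ℝ) c) := by
        refine I.expect_mono fun y hy => ?_
        set z := S.piecewise x y with hz
        have hnn : ∀ v ∈ (T'.visits z).toFinset \ S, 0 ≤ min (y v : ℝ) c := fun v _ =>
          le_min (by positivity) hc0
        split_ifs with hlen
        · have hvis : T'.visits z = T.visits z := I.visits_truncate z T _ b hlen
          rw [mul_one, hvis]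
          rw [hvis] at hnn
          have hk := hT z (I.prob_piecewise_ne_zero S hx hy) hlen
          set A := (T.visits z).toFinset
          have hsum : (k : ℝ) ≤ reward S x + ∑ v ∈ A \ S, (y v : ℝ) := by
            have h1 : reward A z ≤ reward S x + ∑ v ∈ A \ S, (y v : ℕ) := by
              have h2 : reward A z ≤ reward (S ∪ A \ S) z :=
                Finset.sum_le_sum_of_subset (by simp)
              refine h2.trans ?_
              unfold reward
              rw [Finset.sum_union Finset.disjoint_sdiff]
              refine add_le_add (Finset.sum_le_sum fun v hv => ?_) (Finset.sum_le_sum fun v hv => ?_)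
              · simp [hz, hv]
              · simp [hz, (Finset.mem_sdiff.1 hv).2]
            exact_mod_cast hk.trans h1
          -- A single reward reaching the cap `c ≥ r` suffices; otherwise truncation changes nothing
          -- and the untruncated sum is at least `k - reward S x ≥ r`.
          by_cases hex : ∃ v ∈ A \ S, c ≤ (y v : ℝ)
          · obtain ⟨v, hv, hcv⟩ := hex
            calc r ≤ min (y v : ℝ) c := by rw [min_eq_right hcv]; exact hrc
              _ ≤ _ := Finset.single_le_sum hnn hv
          · push Not at hex
            rw [Finset.sum_congr rfl fun v hv => min_eq_left (hex v hv).le]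
            linarith
        · rw [mul_zero]
          exact Finset.sum_nonneg hnn
    _ = _ := I.expect_sum_visits T' S x c
    -- Every realization of the cut-off policy is a tour of length at most `b`, so `hW` applies to
    -- each one.
    _ ≤ I.expect fun _ => W := by
        refine I.expect_mono fun y _ => ?_
        have h0 := I.walkLength_truncate_le (S.piecewise x y) T I.depot b (by rwa [d_self])
        refine le_trans ?_ (hW _ h0)
        rw [profit_truncProfit]
        refine Finset.sum_le_sum_of_subset_of_nonneg ?_ fun v _ _ => ?_
        · refine Finset.sdiff_subset_sdiff (fun v hv => ?_) le_rfl
          simp only [List.toFinset_cons, Finset.mem_insert]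
          exact Or.inr hv
        · exact Finset.sum_nonneg fun j _ =>
            mul_nonneg (I.mass_nonneg v j) (le_min (by positivity) hc0)
    _ = W := I.expect_const W

/-- The expected gain of the tour that an orienteering oracle returns. -/
theorem oracle_gain (I : KTSPInstance V k) {ρ : ℝ} (hρ : 1 ≤ ρ) {O : (V → ℝ) → ℝ → List V}
    (hO : I.IsOrienteeringOracle ρ O) (T : DTree V k) (S : Finset V)
    {x : V → Fin (k + 1)} (hx : I.prob x ≠ 0) {b c r : ℝ} (hb : 0 ≤ b)
    (hr : r ≤ k - reward S x) (hr0 : 0 ≤ r) (hc : 0 < c) (hrc : r ≤ c)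
    (hT : ∀ z, I.prob z ≠ 0 → I.tourLength (T.visits z) ≤ b →
      k ≤ reward (T.visits z).toFinset z) :
    greedyConst / ρ * r *
        I.expect (fun y => if I.tourLength (T.visits (S.piecewise x y)) ≤ b then 1 else 0) ≤
      I.expect fun y => min (∑ v ∈ (I.depot :: O (I.truncProfit c S) b).toFinset \ S, (y v : ℝ))
        c := by
  have hρ0 : 0 < ρ := zero_lt_one.trans_le hρ
  set p := I.expect (fun y => if I.tourLength (T.visits (S.piecewise x y)) ≤ b then 1 else 0)
  have hp1 : p ≤ 1 := by
    rw [← I.expect_one]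
    exact I.expect_mono fun y _ => by split_ifs <;> norm_num
  have hp0 : 0 ≤ p := I.expect_nonneg fun y => by split_ifs <;> norm_num
  obtain ⟨_, h2⟩ := hO (I.truncProfit c S) b (I.truncProfit_nonneg hc.le S) hb
  have h3 := I.expect_short_mul_le T S hx hb hr hr0 hrc hT h2
  rw [profit_truncProfit] at h3
  refine le_trans ?_ (I.le_expect_min_sum _ hc)
  rw [div_mul_eq_mul_div, div_mul_eq_mul_div, mul_assoc, mul_div_assoc]
  refine mul_le_mul_of_nonneg_left (le_min ?_ ?_) greedyConst_pos.le
  · rw [div_le_iff₀ hρ0]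
    nlinarith [mul_le_mul hrc hp1 hp0 hc.le]
  · rwa [div_le_iff₀' hρ0]

end KTSPInstance
end

/-! ### The harmonic potential, the phase recursion and the total length -/

noncomputable section

/-- The difference consists of min(g, r) terms 1/(i + 1) with i < r, each at least 1/r. -/
theorem min_div_le_harmonic_sub (r g : ℕ) :
    min (g : ℝ) r / r ≤ (harmonic r : ℝ) - (harmonic (r - g) : ℝ) := by
  have h : (harmonic r : ℝ) - (harmonic (r - g) : ℝ) =
      ∑ i ∈ Finset.Ico (r - g) r, ((i + 1 : ℕ) : ℝ)⁻¹ := by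
    rw [Finset.sum_Ico_eq_sub _ (Nat.sub_le r g)]
    simp [harmonic]
  rw [h]
  calc min (g : ℝ) r / r = ∑ i ∈ Finset.Ico (r - g) r, (r : ℝ)⁻¹ := by
        have : r - (r - g) = min g r := by omega
        simp [this, div_eq_mul_inv]
    _ ≤ _ := by
        refine Finset.sum_le_sum fun i hi => ?_
        rw [Finset.mem_Ico] at hi
        exact inv_anti₀ (by positivity) (by exact_mod_cast hi.2)

theorem harmonic_mono {m n : ℕ} (h : m ≤ n) : (harmonic m : ℝ) ≤ harmonic n := by
  have h2 : (harmonic m : ℚ) ≤ harmonic n :=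
    Finset.sum_le_sum_of_subset_of_nonneg (Finset.range_subset_range.2 h) fun i _ _ => by positivity
  exact_mod_cast h2

theorem sum_pow_mul_le_of_quarter_recursion {U L : ℕ → ℝ} (hU : ∀ i, 0 ≤ U i) (h0 : U 1 ≤ L 0)
    (h : ∀ i, 1 ≤ i → U (i + 1) ≤ U i / 4 + L i) (n : ℕ) :
    ∑ i ∈ Finset.range n, 2 ^ (i + 1) * U (i + 1) ≤ 4 * ∑ i ∈ Finset.range n, 2 ^ i * L i := by
  -- Counting the last term twice closes the induction: the two new copies make 4·2^(n+1)·U(n+2),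
  -- and the factor 1/4 returns exactly the old extra copy.
  have key : ∀ n, ∑ i ∈ Finset.range (n + 1), 2 ^ (i + 1) * U (i + 1) + 2 ^ (n + 1) * U (n + 1) ≤
      4 * ∑ i ∈ Finset.range (n + 1), 2 ^ i * L i := by
    intro n
    induction n with
    | zero => simp; linarith
    | succ n ih =>
      rw [Finset.sum_range_succ, Finset.sum_range_succ (fun i => 2 ^ i * L i)]
      have h1 := mul_le_mul_of_nonneg_left (h (n + 1) (by omega))
        (by positivity : (0 : ℝ) ≤ 2 ^ (n + 1))
      rw [pow_succ 2 (n + 1)]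
      linarith
  cases n with
  | zero => simp
  | succ n =>
    have := mul_nonneg (by positivity : (0 : ℝ) ≤ 2 ^ (n + 1)) (hU (n + 1))
    linarith [key n]

/-- A geometric sum is less than twice its last term, and the last power that counts is below L. -/
theorem sum_pow_mul_indicator_le {L : ℝ} (hL : 0 ≤ L) (n : ℕ) :
    ∑ i ∈ Finset.range n, (2 : ℝ) ^ i * (if L ≤ 2 ^ i then 0 else 1) ≤ 2 * L := by
  induction n with
  | zero => simpa
  | succ n ih =>
    rw [Finset.sum_range_succ]
    split_ifs with h
    · simpa using ih
    · have h1 : ∑ i ∈ Finset.range n, (2 : ℝ) ^ i * (if L ≤ 2 ^ i then 0 else 1) ≤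
          ∑ i ∈ Finset.range n, (2 : ℝ) ^ i :=
        Finset.sum_le_sum fun i _ => mul_le_of_le_one_right (by positivity)
          (by split_ifs <;> norm_num)
      rw [geom_sum_eq (by norm_num)] at h1
      norm_num at h1 h ⊢
      linarith

theorem sum_range_mul_eq {M : Type*} [AddCommMonoid M] (f : ℕ → M) (a n : ℕ) :
    ∑ m ∈ Finset.range (a * n), f m =
      ∑ i ∈ Finset.range n, ∑ t ∈ Finset.range a, f (a * i + t) := by
  induction n with
  | zero => simp
  | succ n ih => rw [Nat.mul_succ, Finset.sum_range_add, ih, Finset.sum_range_succ]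

namespace KTSPInstance

variable {V : Type*} {k : ℕ}

theorem two_mul_d_le_tourLength (I : KTSPInstance V k) {v : V} {l : List V} (h : v ∈ l) :
    2 * I.d I.depot v ≤ I.tourLength l := by
  have key : ∀ u, I.d u v + I.d v I.depot ≤ I.walkLength u l := by
    induction l with
    | nil => simp at h
    | cons w l ih =>
      intro u
      simp only [walkLength]
      rcases List.mem_cons.1 h with rfl | h
      · exact add_le_add_right (I.d_depot_le_walkLength v l) _
      · have := ih h w
        have := I.d_triangle u w v
        linarith
  have := key I.depot
  rw [I.d_comm v] at this
  unfold tourLength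
  linarith

/-- Reaching any other vertex and returning costs at least 2. Hence phase 0, with bound 1, cannot
leave the depot. -/
theorem Normalized.eq_depot_of_mem {I : KTSPInstance V k} (hI : I.Normalized) {l : List V}
    (hl : I.tourLength l ≤ 1) {v : V} (hv : v ∈ l) : v = I.depot := by
  by_contra h
  have h1 := hI I.depot v (I.depot_pos v h)
  have h2 := I.two_mul_d_le_tourLength hv
  linarith

theorem Normalized.tourLength_eq_zero {I : KTSPInstance V k} (hI : I.Normalized) {l : List V}
    (hl : I.tourLength l ≤ 1) : I.tourLength l = 0 := by
  have h : ∀ v ∈ l, v = I.depot := fun v hv => hI.eq_depot_of_mem hl hv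
  rw [List.eq_replicate_of_mem h]
  induction l.length with
  | zero => exact I.d_self _
  | succ n ih =>
    rw [List.replicate_succ]
    simpa [tourLength, walkLength, d_self] using ih

variable [Fintype V]

/-- After visiting `S` the target is met or no vertex is left. -/
def Finished (S : Finset V) (x : V → Fin (k + 1)) : Prop := k ≤ reward S x ∨ S = Finset.univ

theorem Finished.mono {S S' : Finset V} {x : V → Fin (k + 1)} (h : Finished S x) (hS : S ⊆ S') :
    Finished S' x := by
  rcases h with h | h
  · exact Or.inl (h.trans (Finset.sum_le_sum_of_subset hS))
  · exact Or.inr (Finset.univ_subset_iff.1 (h ▸ hS))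

theorem finished_congr {S : Finset V} {x z : V → Fin (k + 1)} (h : ∀ v ∈ S, x v = z v) :
    Finished S x ↔ Finished S z := by
  rw [Finished, Finished, reward_congr h]

instance [DecidableEq V] (S : Finset V) (x : V → Fin (k + 1)) : Decidable (Finished S x) :=
  inferInstanceAs (Decidable (_ ∨ _))

end KTSPInstance

open KTSPInstance

/-- An exploration of the vertices in rounds: `visited m x` is the set of vertices visited in the
first `m` rounds when the rewards are `x`. The next set depends on the rewards seen so far only. -/
structure Exploration (V : Type*) (k : ℕ) where
  visited : ℕ → (V → Fin (k + 1)) → Finset V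
  visited_zero : ∀ x, visited 0 x = ∅
  visited_subset : ∀ m x, visited m x ⊆ visited (m + 1) x
  predictable : ∀ m x z, (∀ v ∈ visited m x, x v = z v) → visited (m + 1) x = visited (m + 1) z

namespace Exploration

variable {V : Type*} {k : ℕ}

theorem visited_mono (P : Exploration V k) (x : V → Fin (k + 1)) :
    Monotone fun m => P.visited m x :=
  monotone_nat_of_le_succ fun m => P.visited_subset m x

theorem visited_congr (P : Exploration V k) (m : ℕ) (x z : V → Fin (k + 1))
    (h : ∀ v ∈ P.visited m x, x v = z v) : P.visited m x = P.visited m z := by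
  cases m with
  | zero => rw [P.visited_zero, P.visited_zero]
  | succ m => exact P.predictable m x z fun v hv => h v (P.visited_subset m x hv)

/-- The harmonic number of the residual target. -/
def potential (P : Exploration V k) (m : ℕ) (x : V → Fin (k + 1)) : ℝ :=
  (harmonic (k - reward (P.visited m x) x) : ℝ)

theorem potential_anti (P : Exploration V k) (x : V → Fin (k + 1)) :
    Antitone fun m => P.potential m x := fun _ _ hmn =>
  harmonic_mono (Nat.sub_le_sub_left (Finset.sum_le_sum_of_subset (P.visited_mono x hmn)) k)

variable [Fintype V] [DecidableEq V]

/-- The indicator of the event that the exploration is unfinished after `m` rounds. -/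
def unfinished (P : Exploration V k) (m : ℕ) (x : V → Fin (k + 1)) : ℝ :=
  if Finished (P.visited m x) x then 0 else 1

theorem unfinished_nonneg (P : Exploration V k) (m : ℕ) (x : V → Fin (k + 1)) :
    0 ≤ P.unfinished m x := by
  unfold unfinished
  split_ifs <;> norm_num

theorem unfinished_le_one (P : Exploration V k) (m : ℕ) (x : V → Fin (k + 1)) :
    P.unfinished m x ≤ 1 := by
  unfold unfinished
  split_ifs <;> norm_num

theorem unfinished_anti (P : Exploration V k) (x : V → Fin (k + 1)) :
    Antitone fun m => P.unfinished m x := by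
  intro m n hmn
  simp only [unfinished]
  split_ifs with h1 h2 h2
  · exact le_rfl
  · norm_num
  · exact absurd (h2.mono (P.visited_mono x hmn)) h1
  · exact le_rfl

/-- In round `m` the expected gain, capped at the residual target, is at least `c` times the
residual target times the conditional probability that the policy `T` has length at most `b`. -/
def Gains (P : Exploration V k) (I : KTSPInstance V k) (T : DTree V k) (c b : ℝ) (m : ℕ) : Prop :=
  ∀ x, I.prob x ≠ 0 → ¬ Finished (P.visited m x) x →
    c * ((k : ℝ) - reward (P.visited m x) x) * I.expect (fun y =>
        if I.tourLength (T.visits ((P.visited m x).piecewise x y)) ≤ b then 1 else 0) ≤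
      I.expect fun y => min (reward (P.visited (m + 1) x \ P.visited m x) y : ℝ)
        ((k : ℝ) - reward (P.visited m x) x)

/-- Condition on the rewards seen so far: resampling the others changes neither the current and next
visited sets nor the residual target r. Dividing `Gains` by r turns the capped gain into a lower
bound for the drop of the potential. -/
theorem Gains.le_potential {P : Exploration V k} {I : KTSPInstance V k} {T : DTree V k} {c b : ℝ}
    {m : ℕ} (h : P.Gains I T c b m) :
    c * I.expect (fun x => P.unfinished m x * if I.tourLength (T.visits x) ≤ b then 1 else 0) ≤
      I.expect fun x => P.unfinished m x * (P.potential m x - P.potential (m + 1) x) := by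
  rw [I.expect_resample_stopping _ (P.visited_congr m),
    I.expect_resample_stopping _ (P.visited_congr m) (fun x => P.unfinished m x * _),
    ← expect_const_mul]
  refine I.expect_mono fun x hx => ?_
  set S := P.visited m x with hS
  have hagree : ∀ y, ∀ v ∈ P.visited m x, x v = S.piecewise x y v := fun y v hv => by
    rw [Finset.piecewise_eq_of_mem _ _ _ hv]
  have hSz : ∀ y, P.visited m (S.piecewise x y) = S := fun y =>
    (P.visited_congr m x _ (hagree y)).symm
  have hAz : ∀ y, P.visited (m + 1) (S.piecewise x y) = P.visited (m + 1) x := fun y =>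
    (P.predictable m x _ (hagree y)).symm
  have hunf : ∀ y, P.unfinished m (S.piecewise x y) = P.unfinished m x := fun y => by
    simp only [unfinished, hSz, ← hS]
    exact if_congr (finished_congr (hagree y)).symm rfl rfl
  simp only [hunf, expect_const_mul]
  by_cases hfin : Finished S x
  · have : P.unfinished m x = 0 := if_pos hfin
    simp [this]
  · have : P.unfinished m x = 1 := if_neg hfin
    rw [this, one_mul, one_mul]
    have hlt : reward S x < k := by
      by_contra hcon
      exact hfin (Or.inl (not_lt.1 hcon))
    set r := k - reward S x with hr
    have hrR : (k : ℝ) - reward S x = (r : ℝ) := by rw [hr, Nat.cast_sub hlt.le]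
    have hr0 : (0 : ℝ) < r := by
      have : 0 < r := by omega
      exact_mod_cast this
    have h1 := h x hx hfin
    rw [← hS, hrR] at h1
    have h2 : I.expect (fun y => (r : ℝ)⁻¹ * min (reward (P.visited (m + 1) x \ S) y : ℝ) r) ≤
        I.expect fun y => P.potential m (S.piecewise x y) -
          P.potential (m + 1) (S.piecewise x y) := by
      refine I.expect_mono fun y _ => ?_
      have h3 := min_div_le_harmonic_sub r (reward (P.visited (m + 1) x \ S) y)
      have h4 : reward S (S.piecewise x y) = reward S x :=
        (reward_congr (hagree y)).symm
      have h5 : reward (P.visited (m + 1) x) (S.piecewise x y) =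
          reward S x + reward (P.visited (m + 1) x \ S) y := by
        rw [← h4, reward, ← Finset.sum_sdiff (P.visited_subset m x), add_comm]
        refine congrArg₂ _ rfl (Finset.sum_congr rfl fun v hv => ?_)
        rw [Finset.piecewise_eq_of_notMem _ _ _ (Finset.mem_sdiff.1 hv).2]
      rw [potential, potential, hSz, hAz, h4, h5, Nat.sub_add_eq, ← hr, inv_mul_eq_div]
      exact h3
    rw [expect_const_mul] at h2
    refine le_trans ?_ h2
    rw [inv_mul_eq_div, le_div_iff₀ hr0]
    linarith

/-- The probability that the exploration is unfinished drops by a constant factor in a phase,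
up to the probability that the policy `T` is long. -/
theorem expect_unfinished_le (P : Exploration V k) (I : KTSPInstance V k) (T : DTree V k)
    {c b : ℝ} {α s : ℕ} (hα : 0 < α) (hc : 0 < c) (hcα : 4 * (harmonic k : ℝ) ≤ α * c)
    (h : ∀ t < α, P.Gains I T c b (s + t)) :
    I.expect (P.unfinished (s + α)) ≤ I.expect (P.unfinished s) / 4 +
      I.expect fun x => if I.tourLength (T.visits x) ≤ b then 0 else 1 := by
  set U := I.expect (P.unfinished s)
  set U' := I.expect (P.unfinished (s + α))
  set L := I.expect fun x => if I.tourLength (T.visits x) ≤ b then 0 else 1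
  have hU : 0 ≤ U := I.expect_nonneg (P.unfinished_nonneg s)
  -- `U' - L` bounds from below the probability that the exploration is unfinished at the end of the
  -- phase while `T` is short; it is then unfinished in every round of the phase. Weakening the flag
  -- to that of round `s` lets the potentials telescope.
  have h1 : ∀ t ∈ Finset.range α, c * (U' - L) ≤ I.expect fun x =>
      P.unfinished s x * (P.potential (s + t) x - P.potential (s + t + 1) x) := by
    intro t ht
    have ht' := Finset.mem_range.1 ht
    calc c * (U' - L) ≤ c * I.expect (fun x => P.unfinished (s + t) x *
          if I.tourLength (T.visits x) ≤ b then 1 else 0) := by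
          refine mul_le_mul_of_nonneg_left ?_ hc.le
          rw [← expect_sub]
          refine I.expect_mono fun x _ => ?_
          have h2 := P.unfinished_anti x (show s + t ≤ s + α by omega)
          have h3 := P.unfinished_le_one (s + α) x
          have h4 := P.unfinished_nonneg (s + t) x
          simp only at h2
          split_ifs <;> linarith
      _ ≤ _ := (h t ht').le_potential
      _ ≤ _ := I.expect_mono fun x _ => mul_le_mul_of_nonneg_right
          (P.unfinished_anti x (show s ≤ s + t by omega))
          (sub_nonneg.2 (P.potential_anti x (Nat.le_succ _)))
  have h2 := Finset.sum_le_sum h1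
  rw [Finset.sum_const, Finset.card_range, nsmul_eq_mul, ← expect_sum] at h2
  have h3 : I.expect (fun x => ∑ t ∈ Finset.range α, P.unfinished s x *
      (P.potential (s + t) x - P.potential (s + t + 1) x)) ≤ (harmonic k : ℝ) * U := by
    rw [← expect_const_mul]
    refine I.expect_mono fun x _ => ?_
    have htel := Finset.sum_range_sub' (fun t => P.potential (s + t) x) α
    simp only [← add_assoc] at htel
    rw [← Finset.mul_sum, htel, mul_comm]
    refine mul_le_mul_of_nonneg_right ?_ (P.unfinished_nonneg s x)
    have h4 : P.potential (s + 0) x ≤ harmonic k := harmonic_mono (Nat.sub_le _ _)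
    have h5 : (harmonic 0 : ℝ) ≤ P.potential (s + α) x := harmonic_mono (Nat.zero_le _)
    simp only [harmonic_zero, Rat.cast_zero] at h5
    linarith
  have hαc : 0 < (α : ℝ) * c := mul_pos (by exact_mod_cast hα) hc
  have h6 : (α * c) * (U' - L) ≤ (α * c) * (U / 4) := by
    have := mul_le_mul_of_nonneg_right hcα hU
    linarith
  linarith [le_of_mul_le_mul_left h6 hαc]

/-- The total length of an exploration by phases of `α` rounds with geometrically increasing
length bounds, compared with the length of a feasible policy. -/
theorem expect_length_le (P : Exploration V k) {I : KTSPInstance V k} (hI : I.Normalized)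
    {T : DTree V k} (hT : I.Feasible T) {α : ℕ} (hα : 2 ≤ α) {c K : ℝ} (hK : 1 ≤ K) (hc : 0 < c)
    (hcα : 4 * (harmonic k : ℝ) ≤ α * c) (hdepot : ∀ x, I.depot ∈ P.visited 1 x)
    {N : ℕ} {length : (V → Fin (k + 1)) → ℝ} {len : ℕ → (V → Fin (k + 1)) → ℝ}
    (hlength : ∀ x, length x ≤ ∑ m ∈ Finset.range N, P.unfinished m x * len m x)
    (hlen : ∀ m x, 0 ≤ len m x) (hlen0 : ∀ m x, m / α = 0 → len m x = 0)
    (hphase : ∀ i, 1 ≤ i →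
      (∀ m x, m / α = i → len m x ≤ 2 ^ (i + 1) ∧ Finished (P.visited (m + 1) x) x) ∨
      ∀ m, m / α = i → (∀ x, len m x ≤ K * 2 ^ i) ∧ P.Gains I T c (2 ^ i) m) :
    I.expect length ≤ 8 * α * K * I.expect fun x => I.tourLength (T.visits x) := by
  have hα0 : 0 < α := by omega
  have hdiv : ∀ i t, t < α → (α * i + t) / α = i := fun i t ht => by
    rw [Nat.mul_add_div hα0, Nat.div_eq_of_lt ht, add_zero]
  set U : ℕ → ℝ := fun i => I.expect (P.unfinished (α * i)) with hUdef
  set L : ℕ → ℝ := fun i => I.expect fun x => if I.tourLength (T.visits x) ≤ 2 ^ i then 0 else 1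
    with hLdef
  have hU : ∀ i, 0 ≤ U i := fun i => I.expect_nonneg (P.unfinished_nonneg _)
  have hL : ∀ i, 0 ≤ L i := fun i => I.expect_nonneg fun x => by split_ifs <;> norm_num
  -- A run of `T` of length at most 1 visits at most the depot, which the exploration has also
  -- visited by the end of phase 0.
  have hU1 : U 1 ≤ L 0 := by
    refine I.expect_mono fun x hx => ?_
    split_ifs with hlen
    · rw [pow_zero] at hlen
      have hsub : (T.visits x).toFinset ⊆ P.visited (α * 1) x := by
        intro v hv
        rw [hI.eq_depot_of_mem hlen (List.mem_toFinset.1 hv)]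
        exact P.visited_mono x (show 1 ≤ α * 1 by omega) (hdepot x)
      have hf : Finished (T.visits x).toFinset x := hT x hx
      exact (if_pos (hf.mono hsub)).le
    · exact P.unfinished_le_one _ x
  -- A phase that uses the completion tour leaves nothing unfinished, so there the left side
  -- vanishes.
  have hrec : ∀ i, 1 ≤ i → U (i + 1) ≤ U i / 4 + L i := by
    intro i hi
    rcases hphase i hi with h | h
    · have : U (i + 1) ≤ 0 := by
        rw [← I.expect_const 0]
        refine I.expect_mono fun x _ => (if_pos ?_).le
        exact (h (α * i) x (by simpa using hdiv i 0 hα0)).2.mono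
          (P.visited_mono x (by rw [Nat.mul_succ]; omega))
      linarith [hU i, hL i]
    · exact P.expect_unfinished_le I T hα0 hc hcα fun t ht => (h _ (hdiv i t ht)).2
  have hpoint : ∀ x, length x ≤ ∑ i ∈ Finset.range N,
      α * K * (2 ^ (i + 1) * P.unfinished (α * (i + 1)) x) := by
    intro x
    have hnn : ∀ m, 0 ≤ P.unfinished m x * len m x := fun m =>
      mul_nonneg (P.unfinished_nonneg m x) (hlen m x)
    refine (hlength x).trans ?_
    have hN : N ≤ α * (N + 1) := by nlinarith
    refine (Finset.sum_le_sum_of_subset_of_nonneg (Finset.range_subset_range.2 hN)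
      fun m _ _ => hnn m).trans ?_
    rw [sum_range_mul_eq, Finset.sum_range_succ']
    have hzero : ∑ t ∈ Finset.range α, P.unfinished (α * 0 + t) x * len (α * 0 + t) x = 0 :=
      Finset.sum_eq_zero fun t ht => by
        rw [hlen0 _ x (hdiv 0 t (Finset.mem_range.1 ht)), mul_zero]
    rw [hzero, add_zero]
    refine Finset.sum_le_sum fun i _ => ?_
    have hu := P.unfinished_nonneg (α * (i + 1)) x
    rcases hphase (i + 1) (by omega) with h | h
    · rw [Finset.sum_eq_single_of_mem 0 (Finset.mem_range.2 hα0)]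
      · have h1 := (h (α * (i + 1) + 0) x (hdiv _ 0 hα0)).1
        rw [add_zero] at h1 ⊢
        have h2 : (2 : ℝ) ≤ α * K := by
          have : (2 : ℝ) ≤ α := by exact_mod_cast hα
          nlinarith
        calc _ ≤ P.unfinished (α * (i + 1)) x * 2 ^ (i + 1 + 1) :=
              mul_le_mul_of_nonneg_left h1 hu
          _ = 2 * (2 ^ (i + 1) * P.unfinished (α * (i + 1)) x) := by ring
          _ ≤ _ := mul_le_mul_of_nonneg_right h2 (by positivity)
      · intro t ht ht0
        have h1 : Finished (P.visited (α * (i + 1) + t) x) x :=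
          (h (α * (i + 1)) x (by simpa using hdiv (i + 1) 0 hα0)).2.mono
            (P.visited_mono x (by omega))
        rw [unfinished, if_pos h1, zero_mul]
    · calc _ ≤ ∑ t ∈ Finset.range α, P.unfinished (α * (i + 1)) x * (K * 2 ^ (i + 1)) := by
            refine Finset.sum_le_sum fun t ht => ?_
            refine mul_le_mul (P.unfinished_anti x (Nat.le_add_right _ t)) ?_ (hlen _ x) hu
            exact (h _ (hdiv _ t (Finset.mem_range.1 ht))).1 x
        _ = _ := by
            rw [Finset.sum_const, Finset.card_range, nsmul_eq_mul]
            ring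
  calc I.expect length ≤ I.expect fun x => ∑ i ∈ Finset.range N,
        α * K * (2 ^ (i + 1) * P.unfinished (α * (i + 1)) x) := I.expect_mono fun x _ => hpoint x
    _ = α * K * ∑ i ∈ Finset.range N, 2 ^ (i + 1) * U (i + 1) := by
        simp only [expect_sum, expect_const_mul, Finset.mul_sum, hUdef]
    _ ≤ α * K * (4 * ∑ i ∈ Finset.range N, 2 ^ i * L i) := by
        refine mul_le_mul_of_nonneg_left
          (sum_pow_mul_le_of_quarter_recursion hU hU1 hrec N) (by positivity)
    _ ≤ α * K * (4 * I.expect fun x => 2 * I.tourLength (T.visits x)) := by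
        refine mul_le_mul_of_nonneg_left (mul_le_mul_of_nonneg_left ?_ (by norm_num))
          (by positivity)
        simp only [hLdef, ← expect_const_mul]
        rw [← expect_sum]
        exact I.expect_mono fun x _ => sum_pow_mul_indicator_le (I.tourLength_nonneg _) N
    _ = _ := by
        rw [expect_const_mul]
        ring

end Exploration
end

/-! ### The iteration count, the completion tour and termination -/

noncomputable section

/-- Here `c` is the loss of the cap: 1 when the residual target is known, 2 when it is known only up
to a factor two. -/
theorem four_mul_harmonic_le {c ρ : ℝ} {k α : ℕ} (hρ : 1 ≤ ρ) (h : iterBound (4 * c) ρ k ≤ α)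
    (hc : 0 < c) : 4 * (harmonic k : ℝ) ≤ α * (greedyConst / (c * ρ)) := by
  have hg := greedyConst_pos
  have hρ0 : 0 < ρ := by linarith
  rw [iterBound, ← inv_inv (Real.exp 1 / _), ← greedyConst_eq] at h
  rw [mul_div_assoc', le_div_iff₀ (by positivity)]
  calc 4 * (harmonic k : ℝ) * (c * ρ)
      = (4 * c * ρ * greedyConst⁻¹ * harmonic k) * greedyConst := by field_simp
    _ ≤ _ := mul_le_mul_of_nonneg_right h hg.le

theorem two_le_of_iterBound_le {c ρ : ℝ} {k α : ℕ} (hk : 1 ≤ k) (hρ : 1 ≤ ρ)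
    (h : iterBound c ρ k ≤ α) (hc : 2 ≤ c) : 2 ≤ α := by
  have h1 : (1 : ℝ) ≤ greedyConst⁻¹ := (one_le_inv₀ greedyConst_pos).2 greedyConst_lt_one.le
  have h2 : (1 : ℝ) ≤ harmonic k := by
    have := harmonic_mono hk
    simpa [harmonic] using this
  rw [iterBound, ← inv_inv (Real.exp 1 / _), ← greedyConst_eq] at h
  have h3 : 1 * 1 ≤ ρ * greedyConst⁻¹ := mul_le_mul hρ h1 zero_le_one (by linarith)
  have h4 : 1 * 1 * 1 ≤ ρ * greedyConst⁻¹ * harmonic k := mul_le_mul h3 h2 (by norm_num) (by linarith)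
  have h5 : (2 : ℝ) ≤ α := by nlinarith
  exact_mod_cast h5

namespace KTSPInstance

variable {V : Type*} {k : ℕ}

theorem tourLength_depot_cons (I : KTSPInstance V k) (l : List V) :
    I.tourLength (I.depot :: l) = I.tourLength l := by
  simp [tourLength, walkLength, d_self]

theorem walkLength_append_depot_cons (I : KTSPInstance V k) (u : V) (l l' : List V) :
    I.walkLength u (l ++ I.depot :: l') = I.walkLength u l + I.tourLength l' := by
  induction l generalizing u with
  | nil => rfl
  | cons v l ih => simp [walkLength, ih, add_assoc]

/-- Compare with the detour through the depot before every stop. -/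
theorem tourLength_le_two_mul (I : KTSPInstance V k) {D : ℝ} (hD : ∀ v, I.d I.depot v ≤ D)
    (l : List V) : I.tourLength l ≤ 2 * D * l.length := by
  have key : ∀ u, I.walkLength u l ≤ I.d u I.depot + 2 * D * l.length := by
    induction l with
    | nil => intro u; simp [walkLength]
    | cons v l ih =>
      intro u
      have h1 := I.d_triangle u I.depot v
      have h2 := ih v
      rw [I.d_comm v] at h2
      simp only [walkLength, List.length_cons, Nat.cast_succ]
      linarith [hD v]
  have := key I.depot
  rwa [d_self, zero_add] at this

/-- In phase `i` the completion tour replaces the tours of the oracle. -/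
def UsesCompletion (I : KTSPInstance V k) (τ : Option (List V)) (i : ℕ) : Prop :=
  ∃ l, τ = some l ∧ 1 ≤ i ∧ I.tourLength l ≤ 2 ^ (i + 1)

theorem phaseTour_of_not_usesCompletion {I : KTSPInstance V k} {τ : Option (List V)} {i : ℕ}
    (h : ¬ I.UsesCompletion τ i) (π : List V) : I.phaseTour τ i π = π := by
  cases τ with
  | none => rfl
  | some l => exact if_neg fun h' => h ⟨l, rfl, h'⟩

variable [Fintype V]

theorem lt_of_not_finished {S : Finset V} {x : V → Fin (k + 1)} (h : ¬ Finished S x) :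
    reward S x < k := by
  by_contra hcon
  exact h (Or.inl (not_lt.1 hcon))

theorem tourLength_univ_le (I : KTSPInstance V k) {D : ℕ} (hD : ∀ v, I.d I.depot v ≤ D) :
    I.tourLength (Finset.univ : Finset V).toList ≤
      2 ^ (Nat.clog 2 D + Nat.clog 2 (Fintype.card V) + 1) := by
  have h1 := I.tourLength_le_two_mul hD (Finset.univ : Finset V).toList
  rw [Finset.length_toList, Finset.card_univ] at h1
  have h2 : D * Fintype.card V ≤ 2 ^ Nat.clog 2 D * 2 ^ Nat.clog 2 (Fintype.card V) :=
    Nat.mul_le_mul (Nat.le_pow_clog one_lt_two _) (Nat.le_pow_clog one_lt_two _)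
  have h3 : (D : ℝ) * Fintype.card V ≤ 2 ^ Nat.clog 2 D * 2 ^ Nat.clog 2 (Fintype.card V) := by
    exact_mod_cast h2
  rw [pow_succ, pow_add]
  linarith

variable [DecidableEq V]

theorem cost_le_mul_opt (I : KTSPInstance V k) (A : DTree V k) {C : ℝ} (hC : 0 < C)
    (h : ∀ T, I.Feasible T → I.expect (fun x => I.tourLength (A.visits x)) ≤
      C * I.expect fun x => I.tourLength (T.visits x)) :
    I.cost A ≤ ENNReal.ofReal C * I.opt := by
  have hC0 : ENNReal.ofReal C ≠ 0 := by simpa using hC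
  rw [opt, ENNReal.mul_iInf_of_ne hC0 ENNReal.ofReal_ne_top]
  refine le_iInf fun T => ?_
  rw [ENNReal.mul_iInf_of_ne hC0 ENNReal.ofReal_ne_top]
  refine le_iInf fun hT => ?_
  rw [I.cost_eq A fun x => I.tourLength_nonneg _, I.cost_eq T fun x => I.tourLength_nonneg _,
    ← ENNReal.ofReal_mul hC.le]
  exact ENNReal.ofReal_le_ofReal (h T hT)

/-- If `T` visited all vertices within 2^i, a given completion tour would have length at most
2^(i+1) and already be in use. Without one, visiting everything collects `k` anyway. -/
theorem le_reward_of_short {I : KTSPInstance V k} {τ : Option (List V)} (hτ : I.CompletionRule τ)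
    {T : DTree V k} (hT : I.Feasible T) {i : ℕ} (hi : 1 ≤ i) (hu : ¬ I.UsesCompletion τ i)
    {z : V → Fin (k + 1)} (hz : I.prob z ≠ 0) (hlen : I.tourLength (T.visits z) ≤ 2 ^ i) :
    k ≤ reward (T.visits z).toFinset z := by
  rcases hT z hz with h | h
  · exact h
  · cases τ with
    | none => rw [h]; exact hτ z hz
    | some l =>
      refine absurd ⟨l, rfl, hi, ?_⟩ hu
      have := hτ.2 (T.visits z) fun v => List.mem_cons_of_mem _ (by
        rw [← List.mem_toFinset, h]; exact Finset.mem_univ v)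
      rw [pow_succ]
      linarith

theorem completion_of_large_phase {I : KTSPInstance V k} {τ : Option (List V)}
    (hτ : I.CompletionRule τ) {D i : ℕ} (hD : ∀ v, I.d I.depot v ≤ D)
    (hi : Nat.clog 2 D + Nat.clog 2 (Fintype.card V) + 2 ≤ i) :
    I.UsesCompletion τ i ∨ (¬ I.UsesCompletion τ i ∧ ∀ x, I.prob x ≠ 0 → k ≤ ∑ v, (x v : ℕ)) := by
  cases τ with
  | none => exact Or.inr ⟨by simp [UsesCompletion], hτ⟩
  | some l =>
    refine Or.inl ⟨l, rfl, by omega, (hτ.2 (Finset.univ : Finset V).toList (by simp)).trans ?_⟩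
    calc 2 * I.tourLength (Finset.univ : Finset V).toList
        ≤ 2 * 2 ^ (Nat.clog 2 D + Nat.clog 2 (Fintype.card V) + 1) := by
          linarith [I.tourLength_univ_le hD]
      _ = 2 ^ (Nat.clog 2 D + Nat.clog 2 (Fintype.card V) + 1 + 1) := by rw [pow_succ _ (_ + 1)]; ring
      _ ≤ _ := pow_le_pow_right₀ one_le_two (by omega)

/-- With a bound that admits a tour through all vertices, the oracle finds a new vertex as long as
some unvisited vertex has a positive expected reward. -/
theorem oracle_not_subset (I : KTSPInstance V k) {ρ : ℝ} {O : (V → ℝ) → ℝ → List V}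
    (hO : I.IsOrienteeringOracle ρ O) {S : Finset V} {x : V → Fin (k + 1)} (hx : I.prob x ≠ 0)
    (hk : k ≤ ∑ v, (x v : ℕ)) (hS : reward S x < k) {c b : ℝ} (hc : 0 < c)
    (hb : I.tourLength (Finset.univ : Finset V).toList ≤ b) :
    ¬ (I.depot :: O (I.truncProfit c S) b).toFinset ⊆ S := by
  intro hsub
  -- Such a vertex has positive expected truncated reward. So the tour through all vertices has
  -- positive profit, whereas a tour inside `S` has profit 0, contradicting the ratio.
  obtain ⟨v, hvS, hv⟩ : ∃ v, v ∉ S ∧ 0 < (x v : ℕ) := by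
    by_contra! hcon
    have : reward S x = ∑ v, (x v : ℕ) :=
      Finset.sum_subset (Finset.subset_univ S) fun v _ hv => Nat.le_zero.1 (hcon v hv)
    omega
  have hnn : ∀ v, ∀ j : Fin (k + 1), 0 ≤ I.mass v j * min (j : ℝ) c := fun v j =>
    mul_nonneg (I.mass_nonneg v j) (le_min (by positivity) hc.le)
  have hmass : 0 < I.mass v (x v) := by
    refine ENNReal.toReal_pos ((I.prob_ne_zero_iff x).1 hx v) ((I.law v).apply_ne_top _)
  have h1 := (hO (I.truncProfit c S) b (I.truncProfit_nonneg hc.le S)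
    ((I.tourLength_nonneg _).trans hb)).2 _ hb
  rw [profit_truncProfit, profit_truncProfit, Finset.sdiff_eq_empty_iff_subset.2 hsub,
    Finset.sum_empty, mul_zero] at h1
  refine absurd h1 (not_le.2 ?_)
  refine Finset.sum_pos' (fun u _ => Finset.sum_nonneg fun j _ => hnn u j) ⟨v, by simp [hvS], ?_⟩
  refine Finset.sum_pos' (fun j _ => hnn v j) ⟨x v, Finset.mem_univ _, ?_⟩
  have : (0 : ℝ) < (x v : ℕ) := by exact_mod_cast hv
  positivity

end KTSPInstance

open KTSPInstance

theorem Exploration.finished_of_growth {V : Type*} {k : ℕ} [Fintype V] (P : Exploration V k)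
    (x : V → Fin (k + 1)) {m₀ N : ℕ} (hN : m₀ + Fintype.card V ≤ N)
    (h : ∀ m, m₀ ≤ m → ¬ Finished (P.visited m x) x →
      Finished (P.visited (m + 1) x) x ∨ P.visited m x ≠ P.visited (m + 1) x) :
    Finished (P.visited N x) x := by
  -- Each unfinished round adds at least one vertex, so `Fintype.card V` rounds exhaust them.
  have key : ∀ t, Finished (P.visited (m₀ + t) x) x ∨ t ≤ (P.visited (m₀ + t) x).card := by
    intro t
    induction t with
    | zero => exact Or.inr (Nat.zero_le _)
    | succ t ih =>
      by_cases hf : Finished (P.visited (m₀ + t) x) x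
      · exact Or.inl (hf.mono (P.visited_subset _ x))
      · rcases h (m₀ + t) (Nat.le_add_right _ _) hf with h | h
        · exact Or.inl h
        · have := Finset.card_lt_card ((P.visited_subset (m₀ + t) x).ssubset_of_ne h)
          rcases ih with ih | ih
          · exact absurd ih hf
          · exact Or.inr (by rw [← add_assoc]; omega)
  refine Finished.mono ?_ (P.visited_mono x hN)
  rcases key (Fintype.card V) with h | h
  · exact h
  · exact Or.inr (Finset.eq_univ_of_card _ (le_antisymm (Finset.card_le_univ _) h))

/-! ### Ad-kTSP as an exploration -/

namespace KTSPInstance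

variable {V : Type*} {k : ℕ} [DecidableEq V]

theorem reward_insert (S : Finset V) (v : V) (x : V → Fin (k + 1)) :
    reward (insert v S) x = if v ∈ S then reward S x else reward S x + x v := by
  split_ifs with h
  · rw [Finset.insert_eq_of_mem h]
  · rw [reward, Finset.sum_insert h, add_comm]
    rfl

theorem visits_traverse (l : List V) (S : Finset V) (x : V → Fin (k + 1))
    (next : Finset V → ℕ → DTree V k) :
    (traverse l S (reward S x) next).visits x =
      l ++ (next (S ∪ l.toFinset) (reward (S ∪ l.toFinset) x)).visits x := by
  induction l generalizing S with
  | nil => simp [traverse]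
  | cons v l ih =>
    have h : S ∪ (v :: l).toFinset = insert v S ∪ l.toFinset := by
      ext u; simp
    rw [traverse, DTree.visits, ← reward_insert, ih, h, List.cons_append]

variable [Fintype V]

/-- The tour of iteration `m` of Ad-kTSP when `S` is visited with rewards `x`. -/
def adRound (I : KTSPInstance V k) (O : (V → ℝ) → ℝ → List V) (τ : Option (List V)) (α m : ℕ)
    (S : Finset V) (x : V → Fin (k + 1)) : List V :=
  I.phaseTour τ (m / α) (O (I.truncProfit ((k : ℝ) - reward S x) S) (2 ^ (m / α)))

/-- The vertices visited in the first iterations of Ad-kTSP. -/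
def adVisited (I : KTSPInstance V k) (O : (V → ℝ) → ℝ → List V) (τ : Option (List V)) (α : ℕ) :
    ℕ → (V → Fin (k + 1)) → Finset V
  | 0, _ => ∅
  | m + 1, x =>
    if Finished (I.adVisited O τ α m x) x then I.adVisited O τ α m x
    else I.adVisited O τ α m x ∪
      (I.depot :: I.adRound O τ α m (I.adVisited O τ α m x) x).toFinset

theorem adVisited_succ_congr (I : KTSPInstance V k) (O : (V → ℝ) → ℝ → List V)
    (τ : Option (List V)) (α m : ℕ) (x z : V → Fin (k + 1))
    (hm : I.adVisited O τ α m x = I.adVisited O τ α m z)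
    (h : ∀ v ∈ I.adVisited O τ α m x, x v = z v) :
    I.adVisited O τ α (m + 1) x = I.adVisited O τ α (m + 1) z := by
  simp only [adVisited, adRound, ← hm, ← finished_congr h, reward_congr h]

theorem adVisited_subset (I : KTSPInstance V k) (O : (V → ℝ) → ℝ → List V)
    (τ : Option (List V)) (α m : ℕ) (x : V → Fin (k + 1)) :
    I.adVisited O τ α m x ⊆ I.adVisited O τ α (m + 1) x := by
  rw [adVisited]
  split_ifs
  · exact subset_rfl
  · exact Finset.subset_union_left

theorem adVisited_congr (I : KTSPInstance V k) (O : (V → ℝ) → ℝ → List V)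
    (τ : Option (List V)) (α m : ℕ) (x z : V → Fin (k + 1))
    (h : ∀ v ∈ I.adVisited O τ α m x, x v = z v) :
    I.adVisited O τ α m x = I.adVisited O τ α m z := by
  induction m with
  | zero => rfl
  | succ m ih =>
    have h' : ∀ v ∈ I.adVisited O τ α m x, x v = z v := fun v hv =>
      h v (I.adVisited_subset O τ α m x hv)
    exact I.adVisited_succ_congr O τ α m x z (ih h') h'

/-- The exploration of the vertices by Ad-kTSP. -/
def adExploration (I : KTSPInstance V k) (O : (V → ℝ) → ℝ → List V) (τ : Option (List V))
    (α : ℕ) : Exploration V k where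
  visited := I.adVisited O τ α
  visited_zero _ := rfl
  visited_subset := I.adVisited_subset O τ α
  predictable m x z h := I.adVisited_succ_congr O τ α m x z (I.adVisited_congr O τ α m x z h) h

/-- The length of iteration `m` of Ad-kTSP, zero if the algorithm has stopped. -/
def adLen (I : KTSPInstance V k) (O : (V → ℝ) → ℝ → List V) (τ : Option (List V))
    (α m : ℕ) (x : V → Fin (k + 1)) : ℝ :=
  if Finished (I.adVisited O τ α m x) x then 0
  else I.tourLength (I.adRound O τ α m (I.adVisited O τ α m x) x)

/-- This ties the decision tree to the exploration. The shape of `l` belongs to the induction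
because tour lengths add up only where the second list starts at the depot. -/
theorem visits_adKTSPFrom (I : KTSPInstance V k) (O : (V → ℝ) → ℝ → List V)
    (τ : Option (List V)) (α : ℕ) (x : V → Fin (k + 1)) (N m : ℕ) {l : List V}
    (hl : l = (I.adKTSPFrom O τ α N m (I.adVisited O τ α m x)
      (reward (I.adVisited O τ α m x) x)).visits x) :
    (l = [] ∨ ∃ l', l = I.depot :: l') ∧
      I.adVisited O τ α m x ∪ l.toFinset = I.adVisited O τ α (m + N) x ∧
      I.tourLength l = ∑ t ∈ Finset.range N, I.adLen O τ α (m + t) x := by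
  induction N generalizing m l with
  | zero =>
    rw [adKTSPFrom, DTree.visits] at hl
    subst hl
    simp [tourLength, walkLength, d_self]
  | succ N ih =>
    rw [Finset.sum_range_succ', add_zero]
    have hcomm : ∀ t, m + 1 + t = m + (t + 1) := fun t => by omega
    have ih' := @ih (m + 1)
    simp only [hcomm] at ih'
    by_cases hf : Finished (I.adVisited O τ α m x) x
    · have hS : I.adVisited O τ α (m + 1) x = I.adVisited O τ α m x := if_pos hf
      have hdone : ∀ N, I.adKTSPFrom O τ α N m (I.adVisited O τ α m x)
          (reward (I.adVisited O τ α m x) x) = .done := fun N => by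
        cases N with
        | zero => rfl
        | succ N => exact if_pos hf
      have hdone' : I.adKTSPFrom O τ α N (m + 1) (I.adVisited O τ α (m + 1) x)
          (reward (I.adVisited O τ α (m + 1) x) x) = .done := by
        rw [hS]
        cases N with
        | zero => rfl
        | succ N => exact if_pos hf
      obtain ⟨h1, h2, h3⟩ := ih' rfl
      rw [hdone', DTree.visits] at h2 h3
      rw [hdone, DTree.visits] at hl
      subst hl
      rw [← h3, ← h2, hS, adLen, if_pos hf, add_zero]
      exact ⟨Or.inl rfl, rfl, rfl⟩
    · have hf' : ¬ (k ≤ reward (I.adVisited O τ α m x) x ∨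
        I.adVisited O τ α m x = Finset.univ) := hf
      rw [adKTSPFrom, if_neg hf', visits_traverse] at hl
      have hS : I.adVisited O τ α (m + 1) x = I.adVisited O τ α m x ∪
        (I.depot :: I.adRound O τ α m (I.adVisited O τ α m x) x).toFinset := if_neg hf
      unfold adRound at hS
      rw [← hS] at hl
      obtain ⟨h1, h2, h3⟩ := ih' rfl
      set l₂ := (I.adKTSPFrom O τ α N (m + 1) (I.adVisited O τ α (m + 1) x)
          (reward (I.adVisited O τ α (m + 1) x) x)).visits x
      refine ⟨Or.inr ⟨_, hl⟩, ?_, ?_⟩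
      · rw [← h2, hS, hl, List.toFinset_append, Finset.union_assoc]
      · rw [← h3, adLen, if_neg hf, hl, List.cons_append, tourLength_depot_cons, ← adRound]
        rcases h1 with h1 | ⟨l', h1⟩
        · rw [h1, List.append_nil]
          simp [tourLength, walkLength, d_self]
        · rw [h1, tourLength_depot_cons, tourLength, walkLength_append_depot_cons, ← tourLength,
            add_comm]

theorem adKTSP_toFinset (I : KTSPInstance V k) (O : (V → ℝ) → ℝ → List V) (τ : Option (List V))
    (α N : ℕ) (x : V → Fin (k + 1)) :
    ((I.adKTSP O τ α N).visits x).toFinset = I.adVisited O τ α N x := by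
  have := (I.visits_adKTSPFrom O τ α x N 0 rfl).2.1
  simpa [adVisited, adKTSP, reward] using this

theorem adKTSP_tourLength (I : KTSPInstance V k) (O : (V → ℝ) → ℝ → List V)
    (τ : Option (List V)) (α N : ℕ) (x : V → Fin (k + 1)) :
    I.tourLength ((I.adKTSP O τ α N).visits x) = ∑ t ∈ Finset.range N, I.adLen O τ α t x := by
  have := (I.visits_adKTSPFrom O τ α x N 0 rfl).2.2
  simpa [adVisited, adKTSP, reward] using this

theorem adVisited_succ_of_usesCompletion {I : KTSPInstance V k} (O : (V → ℝ) → ℝ → List V)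
    {τ : Option (List V)} (hτ : I.CompletionRule τ) {α m : ℕ} (h : I.UsesCompletion τ (m / α))
    (x : V → Fin (k + 1)) : Finished (I.adVisited O τ α (m + 1) x) x := by
  by_cases hf : Finished (I.adVisited O τ α m x) x
  · exact hf.mono (I.adVisited_subset O τ α m x)
  · obtain ⟨l, rfl, hl⟩ := h
    rw [adVisited, if_neg hf]
    refine Or.inr (Finset.eq_univ_of_forall fun v => Finset.mem_union_right _ ?_)
    have : I.adRound O (some l) α m (I.adVisited O (some l) α m x) x = l := if_pos hl
    rw [this, List.mem_toFinset]
    exact hτ.1 v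

theorem adKTSP_feasible {I : KTSPInstance V k} {ρ : ℝ} {O : (V → ℝ) → ℝ → List V}
    {τ : Option (List V)} (hO : I.IsOrienteeringOracle ρ O) (hτ : I.CompletionRule τ) {α : ℕ}
    (hα : 0 < α) {D N : ℕ} (hD : ∀ v, I.d I.depot v ≤ D)
    (hN : callBound α (Fintype.card V) D ≤ N) : I.Feasible (I.adKTSP O τ α N) := by
  intro x hx
  change Finished ((I.adKTSP O τ α N).visits x).toFinset x
  rw [adKTSP_toFinset]
  refine (I.adExploration O τ α).finished_of_growth x hN fun m hm hf => ?_
  have hi : Nat.clog 2 D + Nat.clog 2 (Fintype.card V) + 2 ≤ m / α := by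
    rw [Nat.le_div_iff_mul_le hα, mul_comm]
    exact hm
  rcases completion_of_large_phase hτ hD hi with h | ⟨h, hk⟩
  · exact Or.inl (adVisited_succ_of_usesCompletion O hτ h x)
  · right
    change ¬ Finished (I.adVisited O τ α m x) x at hf
    change I.adVisited O τ α m x ≠ I.adVisited O τ α (m + 1) x
    rw [adVisited, if_neg hf, adRound, phaseTour_of_not_usesCompletion h]
    intro heq
    have hlt := lt_of_not_finished hf
    refine I.oracle_not_subset hO hx (hk x hx) hlt (sub_pos.2 (by exact_mod_cast hlt)) ?_
      (Finset.union_eq_left.1 heq.symm)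
    exact (I.tourLength_univ_le hD).trans (pow_le_pow_right₀ one_le_two (by omega))

theorem adKTSP_expect_le {I : KTSPInstance V k} (hk : 1 ≤ k) (hI : I.Normalized) {ρ : ℝ}
    (hρ : 1 ≤ ρ) {O : (V → ℝ) → ℝ → List V} {τ : Option (List V)}
    (hO : I.IsOrienteeringOracle ρ O) (hτ : I.CompletionRule τ) {α : ℕ}
    (hα : iterBound 4 ρ k ≤ α) (N : ℕ) {T : DTree V k} (hT : I.Feasible T) :
    I.expect (fun x => I.tourLength ((I.adKTSP O τ α N).visits x)) ≤
      8 * α * 1 * I.expect fun x => I.tourLength (T.visits x) := by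
  have hcα := four_mul_harmonic_le (c := 1) hρ (by simpa using hα) one_pos
  rw [one_mul] at hcα
  have hshort : ∀ m x, ¬ I.UsesCompletion τ (m / α) → I.adLen O τ α m x ≤ 2 ^ (m / α) := by
    intro m x h
    rw [adLen]
    split_ifs with hf
    · positivity
    · rw [adRound, phaseTour_of_not_usesCompletion h]
      have : (0 : ℝ) ≤ (k : ℝ) - reward (I.adVisited O τ α m x) x :=
        sub_nonneg.2 (by exact_mod_cast (lt_of_not_finished hf).le)
      exact (hO _ _ (I.truncProfit_nonneg this _) (by positivity)).1
  have hlen : ∀ m x, 0 ≤ I.adLen O τ α m x := fun m x => by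
    rw [adLen]
    split_ifs
    · exact le_rfl
    · exact I.tourLength_nonneg _
  refine (I.adExploration O τ α).expect_length_le hI hT
    (two_le_of_iterBound_le hk hρ hα (by norm_num)) le_rfl
    (div_pos greedyConst_pos (by linarith)) hcα (N := N) (len := I.adLen O τ α) ?_ ?_ hlen ?_ ?_
  · intro x
    change I.depot ∈ I.adVisited O τ α 1 x
    have hf : ¬ Finished (I.adVisited O τ α 0 x) x := by
      rintro (h | h)
      · simp [adVisited, reward] at h
        omega
      · exact Finset.notMem_empty I.depot (by
          have := Finset.mem_univ I.depot
          rwa [← h] at this)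
    rw [adVisited, if_neg hf]
    simp
  · intro x
    rw [adKTSP_tourLength]
    refine (Finset.sum_congr rfl fun m _ => ?_).le
    rw [Exploration.unfinished, adLen]
    change _ = (if Finished (I.adVisited O τ α m x) x then 0 else 1) * _
    split_ifs <;> simp
  -- In phase 0 the bound is 1, so all tours have length 0.
  · intro m x hm
    have h1 := hshort m x (by simp [UsesCompletion, hm])
    rw [hm, pow_zero] at h1
    rw [adLen] at h1 ⊢
    split_ifs at h1 ⊢
    · rfl
    · exact hI.tourLength_eq_zero h1
  · intro i hi
    by_cases hu : I.UsesCompletion τ i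
    · refine Or.inl fun m x hm => ⟨?_, adVisited_succ_of_usesCompletion O hτ (hm.symm ▸ hu) x⟩
      rw [adLen]
      split_ifs
      · positivity
      · obtain ⟨l, rfl, hl⟩ := hu
        have : I.adRound O (some l) α m (I.adVisited O (some l) α m x) x = l :=
          if_pos (hm.symm ▸ hl)
        rw [this]
        exact hl.2
    · refine Or.inr fun m hm => ⟨fun x => ?_, fun x hx hf => ?_⟩
      · rw [one_mul, ← hm]
        exact hshort m x (hm.symm ▸ hu)
      · change ¬ Finished (I.adVisited O τ α m x) x at hf
        change greedyConst / ρ * ((k : ℝ) - reward (I.adVisited O τ α m x) x) * I.expect (fun y =>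
            if I.tourLength (T.visits ((I.adVisited O τ α m x).piecewise x y)) ≤ 2 ^ i
            then 1 else 0) ≤
          I.expect fun y => min
            (reward (I.adVisited O τ α (m + 1) x \ I.adVisited O τ α m x) y : ℝ)
            ((k : ℝ) - reward (I.adVisited O τ α m x) x)
        have hpos : (0 : ℝ) < (k : ℝ) - reward (I.adVisited O τ α m x) x :=
          sub_pos.2 (by exact_mod_cast lt_of_not_finished hf)
        rw [adVisited, if_neg hf, Finset.union_sdiff_left, adRound,
          phaseTour_of_not_usesCompletion (hm.symm ▸ hu), hm]
        simp only [reward, Nat.cast_sum]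
        -- Ad-kTSP knows its residual target, so cap and target coincide here.
        have := I.oracle_gain hρ hO T (I.adVisited O τ α m x) hx (b := 2 ^ i) (by positivity)
          le_rfl hpos.le hpos le_rfl fun z hz hlen => le_reward_of_short hτ hT hi hu hz hlen
        simpa only [reward, Nat.cast_sum] using this

end KTSPInstance
end

/-! ### NonAd-kTSP and the unknown residual target -/

noncomputable section

namespace KTSPInstance

variable {V : Type*} {k : ℕ}

theorem walkLength_le_append (I : KTSPInstance V k) (u : V) (l l' : List V) :
    I.walkLength u l ≤ I.walkLength u (l ++ l') := by
  induction l generalizing u with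
  | nil => exact I.d_depot_le_walkLength u l'
  | cons v l ih => exact add_le_add_right (ih v) _

theorem tourLength_append_depot_cons (I : KTSPInstance V k) (l l' : List V) :
    I.tourLength (l ++ I.depot :: l') = I.tourLength l + I.tourLength l' :=
  I.walkLength_append_depot_cons _ l l'

theorem _root_.List.IsPrefix.tourLength_le {I : KTSPInstance V k} {l l' : List V} (h : l <+: l') :
    I.tourLength l ≤ I.tourLength l' := by
  obtain ⟨s, rfl⟩ := h
  exact I.walkLength_le_append _ l s

variable [DecidableEq V]

theorem nonAdInner_prefix (I : KTSPInstance V k) (O : (V → ℝ) → ℝ → List V) (i : ℕ) (t : List V)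
    {j j' : ℕ} (h : j ≤ j') : I.nonAdInner O i t j <+: I.nonAdInner O i t j' := by
  induction j', h using Nat.le_induction with
  | base => exact List.prefix_rfl
  | succ j' _ ih => exact ih.trans (List.prefix_append _ _)

theorem nonAdTour_succ_of_usesCompletion {I : KTSPInstance V k} (O : (V → ℝ) → ℝ → List V)
    {l : List V} {α m : ℕ} (h : 1 ≤ m / α ∧ I.tourLength l ≤ 2 ^ (m / α + 1)) :
    I.nonAdTour O (some l) α (m + 1) = I.nonAdTour O (some l) α m ++ I.depot :: l :=
  if_pos h

theorem nonAdTour_succ_of_not_usesCompletion {I : KTSPInstance V k} (O : (V → ℝ) → ℝ → List V)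
    {τ : Option (List V)} {α m : ℕ} (h : ¬ I.UsesCompletion τ (m / α)) :
    I.nonAdTour O τ α (m + 1) =
      I.nonAdInner O (m / α) (I.nonAdTour O τ α m) (1 + Nat.log 2 k) := by
  cases τ with
  | none => rfl
  | some l => exact if_neg fun h' => h ⟨l, rfl, h'⟩

theorem nonAdTour_prefix (I : KTSPInstance V k) (O : (V → ℝ) → ℝ → List V)
    (τ : Option (List V)) (α m : ℕ) : I.nonAdTour O τ α m <+: I.nonAdTour O τ α (m + 1) := by
  by_cases h : I.UsesCompletion τ (m / α)
  · obtain ⟨l, rfl, hl⟩ := h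
    rw [nonAdTour_succ_of_usesCompletion O hl]
    exact List.prefix_append _ _
  · rw [nonAdTour_succ_of_not_usesCompletion O h]
    exact I.nonAdInner_prefix O _ _ (Nat.zero_le _)

theorem _root_.List.IsPrefix.toFinset_subset {l l' : List V} (h : l <+: l') :
    l.toFinset ⊆ l'.toFinset := fun v hv => by
  rw [List.mem_toFinset] at hv ⊢
  exact h.subset hv

theorem union_toFinset_cons (S : Finset V) (v : V) (l : List V) :
    S ∪ (v :: l).toFinset = insert v S ∪ l.toFinset := by
  ext u
  simp

theorem nonAdInner_tourLength_le {I : KTSPInstance V k} {ρ : ℝ} {O : (V → ℝ) → ℝ → List V}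
    (hO : I.IsOrienteeringOracle ρ O) (i : ℕ) (t : List V) (j : ℕ) :
    I.tourLength (I.nonAdInner O i t j) ≤ I.tourLength t + j * 2 ^ i := by
  induction j with
  | zero => simp [nonAdInner]
  | succ j ih =>
    rw [nonAdInner, tourLength_append_depot_cons]
    have := (hO (I.truncProfit ((k : ℝ) / 2 ^ j) (I.nonAdInner O i t j).toFinset) (2 ^ i)
      (I.truncProfit_nonneg (by positivity) _) (by positivity)).1
    push_cast
    linarith

theorem nonAdInner_zero_tourLength {I : KTSPInstance V k} (hI : I.Normalized) {ρ : ℝ}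
    {O : (V → ℝ) → ℝ → List V} (hO : I.IsOrienteeringOracle ρ O) (t : List V) (j : ℕ) :
    I.tourLength (I.nonAdInner O 0 t j) = I.tourLength t := by
  induction j with
  | zero => rfl
  | succ j ih =>
    rw [nonAdInner, tourLength_append_depot_cons, ih, pow_zero,
      hI.tourLength_eq_zero (hO _ _ (I.truncProfit_nonneg (by positivity) _) zero_le_one).1,
      add_zero]

variable [Fintype V]

theorem visits_listPolicyFrom_of_finished (l : List V) {S : Finset V} {x : V → Fin (k + 1)}
    (h : Finished S x) :
    (listPolicyFrom l S (reward S x) : DTree V k).visits x = [] := by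
  cases l with
  | nil => rfl
  | cons v l =>
    have h' : k ≤ reward S x ∨ S = Finset.univ := h
    rw [listPolicyFrom, if_pos h']
    rfl

theorem visits_listPolicyFrom_cons (v : V) (l : List V) {S : Finset V} {x : V → Fin (k + 1)}
    (h : ¬ Finished S x) :
    (listPolicyFrom (v :: l) S (reward S x) : DTree V k).visits x =
      v :: (listPolicyFrom l (insert v S) (reward (insert v S) x) : DTree V k).visits x := by
  have h' : ¬ (k ≤ reward S x ∨ S = Finset.univ) := h
  rw [listPolicyFrom, if_neg h', DTree.visits, ← reward_insert]

theorem visits_listPolicyFrom_prefix (l : List V) (S : Finset V) (x : V → Fin (k + 1)) :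
    (listPolicyFrom l S (reward S x) : DTree V k).visits x <+: l := by
  induction l generalizing S with
  | nil => exact List.prefix_rfl
  | cons v l ih =>
    by_cases hf : Finished S x
    · rw [visits_listPolicyFrom_of_finished _ hf]
      exact List.nil_prefix
    · rw [visits_listPolicyFrom_cons _ _ hf]
      exact (List.prefix_cons_inj v).2 (ih _)

theorem finished_visits_listPolicyFrom (l : List V) (S : Finset V) (x : V → Fin (k + 1))
    (h : Finished (S ∪ l.toFinset) x) :
    Finished (S ∪ ((listPolicyFrom l S (reward S x) : DTree V k).visits x).toFinset) x := by
  induction l generalizing S with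
  | nil => exact h
  | cons v l ih =>
    by_cases hf : Finished S x
    · exact hf.mono Finset.subset_union_left
    · rw [visits_listPolicyFrom_cons _ _ hf, union_toFinset_cons]
      rw [union_toFinset_cons] at h
      exact ih _ h

theorem visits_listPolicyFrom_append (l l' : List V) (S : Finset V) (x : V → Fin (k + 1))
    (h : Finished (S ∪ l.toFinset) x) :
    (listPolicyFrom (l ++ l') S (reward S x) : DTree V k).visits x =
      (listPolicyFrom l S (reward S x) : DTree V k).visits x := by
  induction l generalizing S with
  | nil =>
    rw [List.toFinset_nil, Finset.union_empty] at h
    rw [visits_listPolicyFrom_of_finished _ h, visits_listPolicyFrom_of_finished _ h]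
  | cons v l ih =>
    by_cases hf : Finished S x
    · rw [visits_listPolicyFrom_of_finished _ hf, visits_listPolicyFrom_of_finished _ hf]
    · rw [union_toFinset_cons] at h
      rw [List.cons_append, visits_listPolicyFrom_cons _ _ hf, visits_listPolicyFrom_cons _ _ hf,
        ih _ h]

theorem visits_listPolicyFrom_of_not_finished (l : List V) (S : Finset V) (x : V → Fin (k + 1))
    (h : ¬ Finished (S ∪ l.toFinset) x) :
    (listPolicyFrom l S (reward S x) : DTree V k).visits x = l := by
  induction l generalizing S with
  | nil => rfl
  | cons v l ih =>
    have hf : ¬ Finished S x := fun hf => h (hf.mono Finset.subset_union_left)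
    rw [union_toFinset_cons] at h
    rw [visits_listPolicyFrom_cons _ _ hf, ih _ h]

/-- The exploration of the vertices by NonAd-kTSP. -/
def nonAdExploration (I : KTSPInstance V k) (O : (V → ℝ) → ℝ → List V) (τ : Option (List V))
    (α : ℕ) : Exploration V k where
  visited m _ := (I.nonAdTour O τ α m).toFinset
  visited_zero _ := rfl
  visited_subset m _ := (I.nonAdTour_prefix O τ α m).toFinset_subset
  predictable _ _ _ _ := rfl

/-- A segment of the list is entered only if the target is still open at its start, and is then
charged in full, although the policy may stop inside it. Hence an inequality. -/
theorem nonAdKTSP_tourLength_le (I : KTSPInstance V k) (O : (V → ℝ) → ℝ → List V)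
    (τ : Option (List V)) (α N : ℕ) (x : V → Fin (k + 1)) :
    I.tourLength ((I.nonAdKTSP O τ α N).visits x) ≤ ∑ m ∈ Finset.range N,
      (I.nonAdExploration O τ α).unfinished m x *
        (I.tourLength (I.nonAdTour O τ α (m + 1)) - I.tourLength (I.nonAdTour O τ α m)) := by
  induction N with
  | zero => simp [nonAdKTSP, listPolicy, nonAdTour, listPolicyFrom, DTree.visits, tourLength,
      walkLength, d_self]
  | succ N ih =>
    rw [Finset.sum_range_succ]
    have happ := I.nonAdTour_prefix O τ α N
    unfold nonAdKTSP listPolicy at ih ⊢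
    have h0 : reward ∅ x = 0 := rfl
    rw [← h0] at ih ⊢
    by_cases hf : Finished (I.nonAdTour O τ α N).toFinset x
    · have hu : (I.nonAdExploration O τ α).unfinished N x = 0 := if_pos hf
      obtain ⟨s, hs⟩ := happ
      rw [hu, zero_mul, add_zero, ← hs,
        visits_listPolicyFrom_append _ _ _ _ (by rwa [Finset.empty_union])]
      exact ih
    · have hu : (I.nonAdExploration O τ α).unfinished N x = 1 := if_neg hf
      rw [visits_listPolicyFrom_of_not_finished _ _ _ (by rwa [Finset.empty_union])] at ih
      have := (visits_listPolicyFrom_prefix (I.nonAdTour O τ α (N + 1)) ∅ x).tourLength_le (I := I)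
      rw [hu]
      linarith

theorem finished_nonAdTour_succ {I : KTSPInstance V k} (O : (V → ℝ) → ℝ → List V)
    {τ : Option (List V)} (hτ : I.CompletionRule τ) {α m : ℕ} (h : I.UsesCompletion τ (m / α))
    (x : V → Fin (k + 1)) : Finished (I.nonAdTour O τ α (m + 1)).toFinset x := by
  obtain ⟨l, rfl, hl⟩ := h
  rw [nonAdTour_succ_of_usesCompletion O hl]
  refine Or.inr (Finset.eq_univ_of_forall fun v => ?_)
  rw [List.mem_toFinset]
  exact List.mem_append_right _ (hτ.1 v)

theorem nonAdKTSP_feasible {I : KTSPInstance V k} {ρ : ℝ} {O : (V → ℝ) → ℝ → List V}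
    {τ : Option (List V)} (hk : 1 ≤ k) (hO : I.IsOrienteeringOracle ρ O)
    (hτ : I.CompletionRule τ) {α : ℕ} (hα : 0 < α) {D N : ℕ} (hD : ∀ v, I.d I.depot v ≤ D)
    (hN : callBound α (Fintype.card V) D ≤ N) : I.Feasible (I.nonAdKTSP O τ α N) := by
  intro x hx
  change Finished ((I.nonAdKTSP O τ α N).visits x).toFinset x
  have h0 : reward ∅ x = 0 := rfl
  rw [nonAdKTSP, listPolicy, ← h0, ← Finset.empty_union (List.toFinset _)]
  refine finished_visits_listPolicyFrom _ _ x ?_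
  rw [Finset.empty_union]
  refine (I.nonAdExploration O τ α).finished_of_growth x hN fun m hm hf => ?_
  have hi : Nat.clog 2 D + Nat.clog 2 (Fintype.card V) + 2 ≤ m / α := by
    rw [Nat.le_div_iff_mul_le hα, mul_comm]
    exact hm
  rcases completion_of_large_phase hτ hD hi with h | ⟨h, hkx⟩
  · exact Or.inl (finished_nonAdTour_succ O hτ h x)
  · right
    change ¬ Finished (I.nonAdTour O τ α m).toFinset x at hf
    change (I.nonAdTour O τ α m).toFinset ≠ (I.nonAdTour O τ α (m + 1)).toFinset
    intro heq
    -- The call with `j = 0` suffices, since it sees exactly the list from the start of the round.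
    refine I.oracle_not_subset hO hx (hkx x hx) (lt_of_not_finished hf) (c := (k : ℝ) / 2 ^ 0)
      (b := 2 ^ (m / α)) (by positivity)
      ((I.tourLength_univ_le hD).trans (pow_le_pow_right₀ one_le_two (by omega))) ?_
    rw [nonAdTour_succ_of_not_usesCompletion O h] at heq
    have hsub := (I.nonAdInner_prefix O (m / α) (I.nonAdTour O τ α m)
      (show 0 + 1 ≤ 1 + Nat.log 2 k by omega)).toFinset_subset
    rw [← heq] at hsub
    refine Finset.Subset.trans ?_ hsub
    simp only [nonAdInner, List.toFinset_append]
    exact Finset.subset_union_right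

/-- Here a is the reward already won in the round and G the expected gain capped at c. Because c may
exceed r - a, the gain is scaled by (r - a)/c; what this loses beyond a factor two is made up by a.
-/
theorem half_gain_le {r a c l G : ℝ} (ha : 0 ≤ a) (har : a < r) (hc : 0 < c) (hcr : c ≤ 2 * r)
    (hl0 : 0 ≤ l) (hl1 : l ≤ 1) (hG : l * (r - a) ≤ G) : l / 2 * r ≤ a + (r - a) / c * G := by
  have hr : 0 < r := ha.trans_lt har
  have hra : 0 < r - a := sub_pos.2 har
  calc l / 2 * r ≤ a + (r - a) / (2 * r) * (l * (r - a)) := by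
        have : a + (r - a) / (2 * r) * (l * (r - a)) - l / 2 * r =
            a * (1 - l) + l * a ^ 2 / (2 * r) := by field_simp; ring
        have h2 : 0 ≤ a * (1 - l) := mul_nonneg ha (by linarith)
        have h3 : 0 ≤ l * a ^ 2 / (2 * r) := by positivity
        linarith
    _ ≤ a + (r - a) / c * (l * (r - a)) := by
        gcongr
    _ ≤ _ := by gcongr

/-- The gain of an oracle tour that is computed with a profit cap `c` within a factor two of the
residual target and without knowing the rewards of the vertices added to the list before. -/
theorem oracle_gain_of_cap (I : KTSPInstance V k) {ρ : ℝ} (hρ : 1 ≤ ρ)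
    {O : (V → ℝ) → ℝ → List V} (hO : I.IsOrienteeringOracle ρ O) (T : DTree V k)
    {S s A : Finset V} {x : V → Fin (k + 1)} (hx : I.prob x ≠ 0) {b c r : ℝ} (hb : 0 ≤ b)
    (hr : r = k - reward S x) (hr0 : 0 < r) (hrc : r ≤ c) (hcr : c ≤ 2 * r) (hSs : S ⊆ s)
    (hsA : s ⊆ A) (hA : (I.depot :: O (I.truncProfit c s) b).toFinset ⊆ A)
    (hT : ∀ z, I.prob z ≠ 0 → I.tourLength (T.visits z) ≤ b →
      k ≤ reward (T.visits z).toFinset z) :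
    greedyConst / (2 * ρ) * r *
        I.expect (fun y => if I.tourLength (T.visits (S.piecewise x y)) ≤ b then 1 else 0) ≤
      I.expect fun y => min (reward (A \ S) y : ℝ) r := by
  have hρ0 : 0 < ρ := by linarith
  have hc : 0 < c := hr0.trans_le hrc
  -- Reveal the rewards in `s`, which the oracle call ignored, and apply `oracle_gain` to the state
  -- in which `s` has been visited.
  rw [I.expect_resample s, I.expect_resample s fun y => min (reward (A \ S) y : ℝ) r,
    ← expect_const_mul]
  refine I.expect_mono fun y hy => ?_
  set x' := S.piecewise x y with hx'
  have hx'0 := I.prob_piecewise_ne_zero S hx hy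
  have hpw : ∀ y', S.piecewise x (s.piecewise y y') = s.piecewise x' y' := by
    intro y'
    ext v
    by_cases hv : v ∈ S
    · simp [hx', hv, hSs hv]
    · by_cases hv' : v ∈ s <;> simp [hx', hv, hv']
  simp only [hpw]
  set p := I.expect (fun y' => if I.tourLength (T.visits (s.piecewise x' y')) ≤ b then 1 else 0)
  have hp1 : p ≤ 1 := by
    rw [← I.expect_one]
    exact I.expect_mono fun y _ => by split_ifs <;> norm_num
  have hp0 : 0 ≤ p := I.expect_nonneg fun y => by split_ifs <;> norm_num
  have hl0 : 0 ≤ greedyConst / ρ * p := mul_nonneg (div_nonneg greedyConst_pos.le hρ0.le) hp0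
  have hl1 : greedyConst / ρ * p ≤ 1 :=
    mul_le_one₀ ((div_le_one hρ0).2 (greedyConst_lt_one.le.trans hρ)) hp0 hp1
  have hsplit : ∀ y', (reward (s \ S) y : ℝ) +
      ∑ v ∈ (I.depot :: O (I.truncProfit c s) b).toFinset \ s, (y' v : ℝ) ≤
        reward (A \ S) (s.piecewise y y') := by
    intro y'
    set π := (I.depot :: O (I.truncProfit c s) b).toFinset
    have hdisj : Disjoint (s \ S) (π \ s) :=
      Finset.disjoint_left.2 fun v hv hv' => (Finset.mem_sdiff.1 hv').2 (Finset.mem_sdiff.1 hv).1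
    have h1 : reward (s \ S) y + ∑ v ∈ π \ s, (y' v : ℕ) =
        reward ((s \ S) ∪ (π \ s)) (s.piecewise y y') := by
      rw [reward, reward, Finset.sum_union hdisj]
      refine congrArg₂ _ (Finset.sum_congr rfl fun v hv => ?_) (Finset.sum_congr rfl fun v hv => ?_)
      · rw [Finset.piecewise_eq_of_mem _ _ _ (Finset.mem_sdiff.1 hv).1]
      · rw [Finset.piecewise_eq_of_notMem _ _ _ (Finset.mem_sdiff.1 hv).2]
    have h2 : reward ((s \ S) ∪ (π \ s)) (s.piecewise y y') ≤
        reward (A \ S) (s.piecewise y y') := by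
      refine Finset.sum_le_sum_of_subset (Finset.union_subset
        (Finset.sdiff_subset_sdiff hsA le_rfl) (Finset.sdiff_subset_sdiff hA hSs))
    rw [← h1] at h2
    exact_mod_cast h2
  have ha0 : (0 : ℝ) ≤ reward (s \ S) y := Nat.cast_nonneg _
  have hsum0 : ∀ y' : V → Fin (k + 1),
      0 ≤ ∑ v ∈ (I.depot :: O (I.truncProfit c s) b).toFinset \ s, (y' v : ℝ) := fun y' =>
    Finset.sum_nonneg fun v _ => Nat.cast_nonneg _
  have hlhs : greedyConst / (2 * ρ) * r * p = greedyConst / ρ * p / 2 * r := by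
    field_simp
  rw [hlhs]
  by_cases har : (reward (s \ S) y : ℝ) < r
  · have hrew : (k : ℝ) - reward s x' = r - reward (s \ S) y := by
      have : reward s x' = reward (s \ S) y + reward S x := by
        rw [reward, ← Finset.sum_sdiff hSs]
        refine congrArg₂ _ (Finset.sum_congr rfl fun v hv => ?_)
          (Finset.sum_congr rfl fun v hv => ?_)
        · rw [hx', Finset.piecewise_eq_of_notMem _ _ _ (Finset.mem_sdiff.1 hv).2]
        · rw [hx', Finset.piecewise_eq_of_mem _ _ _ hv]
      rw [this, hr]
      push_cast
      ring
    have hG := I.oracle_gain hρ hO T s hx'0 hb hrew.ge (sub_pos.2 har).le hc (by linarith) hT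
    rw [mul_right_comm] at hG
    refine (half_gain_le ha0 har hc hcr hl0 hl1 hG).trans ?_
    rw [← expect_const_mul, ← I.expect_const (reward (s \ S) y : ℝ), ← expect_add]
    -- With X the new reward, a + ((r - a)/c)·min(X, c) is at most a + X because r - a ≤ c, and at
    -- most r because min(X, c) ≤ c.
    refine I.expect_mono fun y' _ => le_min ?_ ?_
    · rw [I.expect_const]
      refine le_trans (add_le_add_right ?_ _) (hsplit y')
      refine (mul_le_of_le_one_left (le_min (hsum0 y') hc.le) ?_).trans (min_le_left _ _)
      rw [div_le_one hc]
      linarith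
    · rw [I.expect_const]
      have := mul_le_mul_of_nonneg_left (min_le_right
        (∑ v ∈ (I.depot :: O (I.truncProfit c s) b).toFinset \ s, (y' v : ℝ)) c)
        (div_pos (sub_pos.2 har) hc).le
      rw [div_mul_cancel₀ _ hc.ne'] at this
      linarith
  · calc greedyConst / ρ * p / 2 * r ≤ r := mul_le_of_le_one_left hr0.le (by linarith)
      _ = I.expect fun _ => r := (I.expect_const r).symm
      _ ≤ _ := I.expect_mono fun y' _ => le_min (by linarith [hsplit y', hsum0 y']) le_rfl

theorem nonAdKTSP_expect_le {I : KTSPInstance V k} (hk : 1 ≤ k) (hI : I.Normalized) {ρ : ℝ}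
    (hρ : 1 ≤ ρ) {O : (V → ℝ) → ℝ → List V} {τ : Option (List V)}
    (hO : I.IsOrienteeringOracle ρ O) (hτ : I.CompletionRule τ) {α : ℕ}
    (hα : iterBound 8 ρ k ≤ α) (N : ℕ) {T : DTree V k} (hT : I.Feasible T) :
    I.expect (fun x => I.tourLength ((I.nonAdKTSP O τ α N).visits x)) ≤
      8 * α * (1 + Nat.log 2 k : ℕ) * I.expect fun x => I.tourLength (T.visits x) := by
  have hcα := four_mul_harmonic_le (c := 2) hρ (by norm_num; exact hα) two_pos
  have hα2 := two_le_of_iterBound_le hk hρ hα (by norm_num)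
  refine (I.nonAdExploration O τ α).expect_length_le hI hT hα2 (by simp)
    (div_pos greedyConst_pos (by linarith)) hcα (N := N)
    (len := fun m _ => I.tourLength (I.nonAdTour O τ α (m + 1)) -
      I.tourLength (I.nonAdTour O τ α m)) ?_ (I.nonAdKTSP_tourLength_le O τ α N) ?_ ?_ ?_
  · intro x
    change I.depot ∈ (I.nonAdTour O τ α 1).toFinset
    rw [nonAdTour_succ_of_not_usesCompletion O (by simp [UsesCompletion]), List.mem_toFinset]
    refine (I.nonAdInner_prefix O _ _ (show 0 + 1 ≤ 1 + Nat.log 2 k by omega)).subset ?_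
    simp [nonAdInner]
  · exact fun m _ => sub_nonneg.2 (I.nonAdTour_prefix O τ α m).tourLength_le
  · intro m x hm
    rw [nonAdTour_succ_of_not_usesCompletion O (by simp [UsesCompletion, hm]), hm,
      nonAdInner_zero_tourLength hI hO, sub_self]
  · intro i hi
    by_cases hu : I.UsesCompletion τ i
    · refine Or.inl fun m x hm => ⟨?_, finished_nonAdTour_succ O hτ (hm.symm ▸ hu) x⟩
      obtain ⟨l, rfl, hl⟩ := hu
      rw [nonAdTour_succ_of_usesCompletion O (hm.symm ▸ hl), tourLength_append_depot_cons,
        add_sub_cancel_left]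
      exact hl.2
    · refine Or.inr fun m hm => ⟨fun _ => ?_, fun x hx hf => ?_⟩
      · rw [nonAdTour_succ_of_not_usesCompletion O (hm.symm ▸ hu), hm]
        linarith [nonAdInner_tourLength_le hO i (I.nonAdTour O τ α m) (1 + Nat.log 2 k)]
      · have hlt : reward (I.nonAdTour O τ α m).toFinset x < k := lt_of_not_finished hf
        change greedyConst / (2 * ρ) *
            ((k : ℝ) - reward (I.nonAdTour O τ α m).toFinset x) * I.expect (fun y =>
              if I.tourLength (T.visits ((I.nonAdTour O τ α m).toFinset.piecewise x y)) ≤ 2 ^ i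
              then 1 else 0) ≤
          I.expect fun y => min (reward ((I.nonAdTour O τ α (m + 1)).toFinset \
            (I.nonAdTour O τ α m).toFinset) y : ℝ)
            ((k : ℝ) - reward (I.nonAdTour O τ α m).toFinset x)
        rw [nonAdTour_succ_of_not_usesCompletion O (hm.symm ▸ hu), hm]
        set t := I.nonAdTour O τ α m
        set r := k - reward t.toFinset x with hr
        have hr0 : 0 < r := by omega
        have hrR : (k : ℝ) - reward t.toFinset x = (r : ℝ) := by rw [hr, Nat.cast_sub hlt.le]
        -- This index gives r ≤ k/2^j < 2r, and j ≤ ⌊log₂ k⌋, so the inner loop reaches it.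
        set j := Nat.log 2 (k / r)
        have hkr : k / r ≠ 0 := (Nat.div_pos (Nat.sub_le _ _) hr0).ne'
        have h1 : 2 ^ j * r ≤ k := (Nat.mul_le_mul_right r (Nat.pow_log_le_self 2 hkr)).trans
          (Nat.div_mul_le_self k r)
        have h2 : k < 2 ^ (j + 1) * r :=
          (Nat.div_lt_iff_lt_mul hr0).1 (Nat.lt_pow_succ_log_self one_lt_two _)
        have h1R : (2 : ℝ) ^ j * r ≤ k := by exact_mod_cast h1
        have h2R : (k : ℝ) < 2 ^ (j + 1) * r := by exact_mod_cast h2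
        have hj : j + 1 ≤ 1 + Nat.log 2 k := by
          have : j ≤ Nat.log 2 k := Nat.log_mono_right (Nat.div_le_self _ _)
          omega
        have h2j : (0 : ℝ) < 2 ^ j := by positivity
        have hstep := (I.nonAdInner_prefix O i t hj).toFinset_subset
        rw [nonAdInner, List.toFinset_append] at hstep
        rw [hrR]
        refine I.oracle_gain_of_cap hρ hO T hx (b := 2 ^ i) (c := (k : ℝ) / 2 ^ j) (by positivity)
          hrR.symm (by exact_mod_cast hr0) ?_ ?_
          (I.nonAdInner_prefix O i t (Nat.zero_le j)).toFinset_subset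
          (Finset.union_subset_left hstep) (Finset.union_subset_right hstep)
          fun z hz hlen => le_reward_of_short hτ hT hi hu hz hlen
        · rw [le_div_iff₀ h2j]
          linarith
        · rw [div_le_iff₀ h2j]
          rw [pow_succ] at h2R
          linarith

end KTSPInstance
end

/-! ### Constants, scaling and the adaptivity gap -/

noncomputable section

/-- The factor e/(e - 1) is at most 2, and the 1 lost by rounding up is at most ρ(1 + log k). -/
theorem natCeil_iterBound_le {c ρ : ℝ} {k : ℕ} (hρ : 1 ≤ ρ) (hc : 0 ≤ c) :
    (⌈iterBound c ρ k⌉₊ : ℝ) ≤ (2 * c + 1) * ρ * (1 + Real.log k) := by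
  have hlog : 0 ≤ Real.log k := Real.log_natCast_nonneg k
  have hH : (harmonic k : ℝ) ≤ 1 + Real.log k := harmonic_le_one_add_log k
  have hH0 : (0 : ℝ) ≤ harmonic k := by
    have := harmonic_mono (Nat.zero_le k)
    simpa using this
  have he : Real.exp 1 / (Real.exp 1 - 1) ≤ 2 := by
    have := Real.exp_one_gt_d9
    rw [div_le_iff₀ (by linarith)]
    linarith
  have he0 : 0 ≤ Real.exp 1 / (Real.exp 1 - 1) := by
    rw [← inv_inv (_ / _), ← greedyConst_eq]
    exact inv_nonneg.2 greedyConst_pos.le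
  have hρ0 : 0 ≤ ρ := by linarith
  have h1 : iterBound c ρ k ≤ c * ρ * 2 * (1 + Real.log k) := by
    unfold iterBound
    gcongr
  have h2 : 0 ≤ iterBound c ρ k := by
    unfold iterBound
    positivity
  have h3 := (Nat.ceil_lt_add_one h2).le
  have h4 : (1 : ℝ) * 1 ≤ ρ * (1 + Real.log k) :=
    mul_le_mul hρ (by linarith) zero_le_one hρ0
  linarith

theorem one_add_log_two_le {k : ℕ} (hk : 1 ≤ k) :
    ((1 + Nat.log 2 k : ℕ) : ℝ) ≤ 2 * (1 + Real.log k) := by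
  have h1 : ((2 ^ Nat.log 2 k : ℕ) : ℝ) ≤ k := by
    exact_mod_cast Nat.pow_log_le_self 2 (by omega)
  have h2 := Real.log_le_log (by positivity) h1
  rw [Nat.cast_pow, Real.log_pow, Nat.cast_ofNat] at h2
  have h3 := Real.log_two_gt_d9
  have h4 : (Nat.log 2 k : ℝ) * (1 / 2) ≤ Nat.log 2 k * Real.log 2 := by
    gcongr
    linarith
  push_cast
  linarith

namespace KTSPInstance

variable {V : Type*} {k : ℕ}

/-- The instance with all distances multiplied by `s`. -/
def scale (I : KTSPInstance V k) (s : ℝ) (hs : 0 < s) : KTSPInstance V k where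
  metric :=
    { dist := fun u v => s * I.d u v
      dist_self := fun u => by simp [d_self]
      dist_comm := fun u v => by rw [d_comm]
      dist_triangle := fun u v w => by
        rw [← mul_add]
        exact mul_le_mul_of_nonneg_left (I.d_triangle u v w) hs.le }
  depot := I.depot
  depot_pos v hv := mul_pos hs (I.depot_pos v hv)
  law := I.law

theorem scale_d (I : KTSPInstance V k) (s : ℝ) (hs : 0 < s) (u v : V) :
    (I.scale s hs).d u v = s * I.d u v := rfl

theorem scale_tourLength (I : KTSPInstance V k) (s : ℝ) (hs : 0 < s) (l : List V) :
    (I.scale s hs).tourLength l = s * I.tourLength l := by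
  have key : ∀ u, (I.scale s hs).walkLength u l = s * I.walkLength u l := by
    induction l with
    | nil => exact fun u => rfl
    | cons v l ih =>
      intro u
      rw [walkLength, walkLength, ih, mul_add]
      rfl
  exact key _

theorem exists_normalized_scale [Finite V] (I : KTSPInstance V k) :
    ∃ (s : ℝ) (hs : 0 < s), (I.scale s hs).Normalized := by
  have := Fintype.ofFinite V
  have hnn : ∀ p : V × V, 0 ≤ (I.d p.1 p.2)⁻¹ := fun p => inv_nonneg.2 (I.d_nonneg _ _)
  -- This factor exceeds the inverse of every positive distance; zero distances contribute 0, and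
  -- the 1 keeps it positive in all cases.
  refine ⟨1 + ∑ p : V × V, (I.d p.1 p.2)⁻¹,
    add_pos_of_pos_of_nonneg one_pos (Finset.sum_nonneg fun p _ => hnn p), fun u v huv => ?_⟩
  rw [scale_d] at huv ⊢
  have hd : 0 < I.d u v := by
    refine (I.d_nonneg u v).lt_of_ne fun h => ?_
    rw [← h, mul_zero] at huv
    exact lt_irrefl _ huv
  have h1 : (I.d u v)⁻¹ ≤ ∑ p : V × V, (I.d p.1 p.2)⁻¹ :=
    Finset.single_le_sum (f := fun p : V × V => (I.d p.1 p.2)⁻¹) (fun p _ => hnn p)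
      (Finset.mem_univ (u, v))
  calc (1 : ℝ) = (I.d u v)⁻¹ * I.d u v := (inv_mul_cancel₀ hd.ne').symm
    _ ≤ _ := mul_le_mul_of_nonneg_right (by linarith) hd.le

/-- There are infinitely many lists, but the profit depends only on the set of stops, and there are
finitely many sets. -/
theorem exists_isOrienteeringOracle [Finite V] [DecidableEq V] (I : KTSPInstance V k) :
    ∃ O, I.IsOrienteeringOracle 1 O := by
  have h : ∀ (w : V → ℝ) (B : ℝ), ∃ l, 0 ≤ B → I.tourLength l ≤ B ∧
      ∀ l', I.tourLength l' ≤ B → I.profit w l' ≤ I.profit w l := by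
    intro w B
    by_cases hB : 0 ≤ B
    · obtain ⟨_, ⟨l, hl, rfl⟩, hmax⟩ := Set.exists_max_image
        ((fun l => (I.depot :: l).toFinset) '' {l | I.tourLength l ≤ B})
        (fun A => ∑ v ∈ A, w v) (Set.toFinite _)
        ⟨_, [], by simpa [tourLength, walkLength, d_self] using hB, rfl⟩
      exact ⟨l, fun _ => ⟨hl, fun l' hl' => hmax _ ⟨l', hl', rfl⟩⟩⟩
    · exact ⟨[], fun h => absurd h hB⟩
  choose O hO using h
  exact ⟨O, fun w B _ hB => ⟨(hO w B hB).1, fun l hl => by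
    rw [one_mul]
    exact (hO w B hB).2 l hl⟩⟩

variable [Fintype V]

theorem exists_nat_radius (I : KTSPInstance V k) : ∃ D : ℕ, ∀ v, I.d I.depot v ≤ D := by
  obtain ⟨D, hD⟩ := exists_nat_ge (∑ v, I.d I.depot v)
  exact ⟨D, fun v => (Finset.single_le_sum (f := fun v => I.d I.depot v)
    (fun v _ => I.d_nonneg _ v) (Finset.mem_univ v)).trans hD⟩

variable [DecidableEq V]

/-- Minimizing the integer part of the length avoids showing that a shortest tour exists. The error
is less than 1, hence less than the length of any tour that leaves the depot. -/
theorem Normalized.exists_completionRule {I : KTSPInstance V k} (hI : I.Normalized) :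
    ∃ τ, I.CompletionRule τ := by
  by_cases h : ∃ v, v ≠ I.depot
  · obtain ⟨v, hv⟩ := h
    obtain ⟨l, hl, hmin⟩ := (measure fun l : List V => ⌊I.tourLength l⌋₊).wf.has_min
      {l | ∀ v, v ∈ I.depot :: l} ⟨(Finset.univ : Finset V).toList, by simp⟩
    refine ⟨some l, hl, fun l' hl' => ?_⟩
    have h1 : ⌊I.tourLength l⌋₊ ≤ ⌊I.tourLength l'⌋₊ := not_lt.1 (hmin l' hl')
    have h2 := Nat.lt_floor_add_one (I.tourLength l)
    have h3 := Nat.floor_le (I.tourLength_nonneg l')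
    have h4 : (⌊I.tourLength l⌋₊ : ℝ) ≤ ⌊I.tourLength l'⌋₊ := by exact_mod_cast h1
    have h5 := I.two_mul_d_le_tourLength (List.mem_of_ne_of_mem hv (hl' v))
    have h6 := hI I.depot v (I.depot_pos v hv)
    linarith
  · push Not at h
    refine ⟨some [], fun v => by simp [h v], fun l _ => ?_⟩
    have h1 : I.tourLength [] = 0 := I.d_self _
    linarith [I.tourLength_nonneg l]

theorem adKTSP_cost_le {I : KTSPInstance V k} (hk : 1 ≤ k) (hI : I.Normalized) {ρ : ℝ}
    (hρ : 1 ≤ ρ) {O : (V → ℝ) → ℝ → List V} {τ : Option (List V)}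
    (hO : I.IsOrienteeringOracle ρ O) (hτ : I.CompletionRule τ) {α : ℕ}
    (hα : iterBound 4 ρ k ≤ α) (N : ℕ) : I.cost (I.adKTSP O τ α N) ≤ (8 * α) * I.opt := by
  have hα0 : 0 < (α : ℝ) := by
    have := two_le_of_iterBound_le hk hρ hα (by norm_num)
    exact_mod_cast (by omega : 0 < α)
  have h := I.cost_le_mul_opt (I.adKTSP O τ α N) (C := 8 * α) (by positivity) fun T hT => by
    simpa using adKTSP_expect_le hk hI hρ hO hτ hα N hT
  rwa [ENNReal.ofReal_mul (by norm_num), ENNReal.ofReal_natCast, ENNReal.ofReal_ofNat] at h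

theorem nonAdKTSP_cost_le {I : KTSPInstance V k} (hk : 1 ≤ k) (hI : I.Normalized) {ρ : ℝ}
    (hρ : 1 ≤ ρ) {O : (V → ℝ) → ℝ → List V} {τ : Option (List V)}
    (hO : I.IsOrienteeringOracle ρ O) (hτ : I.CompletionRule τ) {α : ℕ}
    (hα : iterBound 8 ρ k ≤ α) (N : ℕ) :
    I.cost (I.nonAdKTSP O τ α N) ≤ (8 * α * (1 + Nat.log 2 k : ℕ)) * I.opt := by
  have hα0 : 0 < (α : ℝ) := by
    have := two_le_of_iterBound_le hk hρ hα (by norm_num)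
    exact_mod_cast (by omega : 0 < α)
  have h := I.cost_le_mul_opt (I.nonAdKTSP O τ α N) (C := 8 * α * (1 + Nat.log 2 k : ℕ))
    (by positivity) fun T hT => nonAdKTSP_expect_le hk hI hρ hO hτ hα N hT
  rwa [ENNReal.ofReal_mul (by positivity), ENNReal.ofReal_mul (by norm_num),
    ENNReal.ofReal_natCast, ENNReal.ofReal_natCast, ENNReal.ofReal_ofNat] at h

theorem eight_mul_natCeil_mul_le {ρ : ℝ} (hk : 1 ≤ k) (hρ : 1 ≤ ρ) :
    8 * (⌈iterBound 8 ρ k⌉₊ : ℝ) * (1 + Nat.log 2 k : ℕ) ≤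
      272 * ρ * (1 + Real.log k) ^ 2 := by
  have hlog : 0 ≤ Real.log k := Real.log_natCast_nonneg k
  calc 8 * (⌈iterBound 8 ρ k⌉₊ : ℝ) * (1 + Nat.log 2 k : ℕ)
      ≤ 8 * ((2 * 8 + 1) * ρ * (1 + Real.log k)) * (2 * (1 + Real.log k)) := by
        gcongr
        · exact natCeil_iterBound_le hρ (by norm_num)
        · exact one_add_log_two_le hk
    _ = _ := by ring

/-- Feasibility does not involve the metric and lengths scale linearly, so the list computed for a
normalized rescaling with an exact oracle serves the original instance. -/
theorem nonAdaptiveOpt_le (I : KTSPInstance V k) (hk : 1 ≤ k) :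
    I.nonAdaptiveOpt ≤ ENNReal.ofReal (272 * (1 + Real.log k) ^ 2) * I.opt := by
  obtain ⟨s, hs, hI⟩ := I.exists_normalized_scale
  set I' := I.scale s hs
  obtain ⟨O, hO⟩ := I'.exists_isOrienteeringOracle
  obtain ⟨τ, hτ⟩ := hI.exists_completionRule
  obtain ⟨D, hD⟩ := I'.exists_nat_radius
  set α := ⌈iterBound 8 1 k⌉₊
  have hα : iterBound 8 1 k ≤ α := Nat.le_ceil _
  have hα2 := two_le_of_iterBound_le hk le_rfl hα (by norm_num)
  set N := callBound α (Fintype.card V) D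
  have hfeas : I.Feasible (listPolicy k (I'.nonAdTour O τ α N)) :=
    nonAdKTSP_feasible hk hO hτ (by omega) hD le_rfl
  have hlog : 0 ≤ Real.log k := Real.log_natCast_nonneg k
  have hle : I.nonAdaptiveOpt ≤ I.cost (listPolicy k (I'.nonAdTour O τ α N)) :=
    iInf₂_le (f := fun l (_ : I.Feasible (listPolicy k l)) => I.cost (listPolicy k l)) _ hfeas
  refine hle.trans (I.cost_le_mul_opt _ (C := 272 * (1 + Real.log k) ^ 2) (by positivity)
    fun T hT => ?_)
  have h := nonAdKTSP_expect_le hk hI le_rfl hO hτ hα N (T := T) hT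
  simp only [I', scale_tourLength, expect_const_mul] at h
  change s * I.expect _ ≤ _ * (s * I.expect _) at h
  rw [mul_left_comm] at h
  refine (le_of_mul_le_mul_left h hs).trans (mul_le_mul_of_nonneg_right ?_
    (I.expect_nonneg fun x => I.tourLength_nonneg _))
  simpa using eight_mul_natCeil_mul_le hk (le_refl (1 : ℝ))

end KTSPInstance
end

theorem theorem1 :
    -- (1) With a ρ-approximate orienteering oracle, Ad-kTSP is an 8α-approximation.
    (∀ (V : Type*) [Fintype V] [DecidableEq V] (k : ℕ) (I : KTSPInstance V k) (ρ : ℝ)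
      (O : (V → ℝ) → ℝ → List V) (τ : Option (List V)),
      1 ≤ k → I.Normalized → 1 ≤ ρ → I.IsOrienteeringOracle ρ O → I.CompletionRule τ →
      ∀ α : ℕ, iterBound 4 ρ k ≤ α →
      ∀ D N : ℕ, (∀ v, I.d I.depot v ≤ D) → callBound α (Fintype.card V) D ≤ N →
        I.Feasible (I.adKTSP O τ α N) ∧
        I.cost (I.adKTSP O τ α N) ≤ (8 * α) * I.opt) ∧
    -- (2) NonAd-kTSP is an 8αℓ-approximation to the optimal adaptive policy, ℓ = 1 + ⌊log₂ k⌋.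
    (∀ (V : Type*) [Fintype V] [DecidableEq V] (k : ℕ) (I : KTSPInstance V k) (ρ : ℝ)
      (O : (V → ℝ) → ℝ → List V) (τ : Option (List V)),
      1 ≤ k → I.Normalized → 1 ≤ ρ → I.IsOrienteeringOracle ρ O → I.CompletionRule τ →
      ∀ α : ℕ, iterBound 8 ρ k ≤ α →
      ∀ D N : ℕ, (∀ v, I.d I.depot v ≤ D) → callBound α (Fintype.card V) D ≤ N →
        I.Feasible (I.nonAdKTSP O τ α N) ∧
        I.cost (I.nonAdKTSP O τ α N) ≤ (8 * α * (1 + Nat.log 2 k : ℕ)) * I.opt) ∧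
    -- (3) With α the least admissible integer, the ratios are O(ρ log k) and O(ρ log² k).
    (∃ C : ℝ, 0 < C ∧
      ∀ (V : Type*) [Fintype V] [DecidableEq V] (k : ℕ) (I : KTSPInstance V k) (ρ : ℝ)
      (O : (V → ℝ) → ℝ → List V) (τ : Option (List V)),
      1 ≤ k → I.Normalized → 1 ≤ ρ → I.IsOrienteeringOracle ρ O → I.CompletionRule τ →
      ∀ D : ℕ, (∀ v, I.d I.depot v ≤ D) →
        (∀ N : ℕ, callBound ⌈iterBound 4 ρ k⌉₊ (Fintype.card V) D ≤ N →
          I.cost (I.adKTSP O τ ⌈iterBound 4 ρ k⌉₊ N) ≤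
            ENNReal.ofReal (C * ρ * (1 + Real.log k)) * I.opt) ∧
        (∀ N : ℕ, callBound ⌈iterBound 8 ρ k⌉₊ (Fintype.card V) D ≤ N →
          I.cost (I.nonAdKTSP O τ ⌈iterBound 8 ρ k⌉₊ N) ≤
            ENNReal.ofReal (C * ρ * (1 + Real.log k) ^ 2) * I.opt)) ∧
    -- (4) The adaptivity gap is O(log² k).
    (∃ C : ℝ, 0 < C ∧
      ∀ (V : Type*) [Fintype V] [DecidableEq V] (k : ℕ) (I : KTSPInstance V k), 1 ≤ k →
        I.nonAdaptiveOpt ≤ ENNReal.ofReal (C * (1 + Real.log k) ^ 2) * I.opt) := by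
  refine ⟨?_, ?_, ⟨272, by norm_num, ?_⟩, ⟨272, by norm_num, fun V _ _ k I hk =>
    I.nonAdaptiveOpt_le hk⟩⟩
  · intro V _ _ k I ρ O τ hk hI hρ hO hτ α hα D N hD hN
    have hα2 := two_le_of_iterBound_le hk hρ hα (by norm_num)
    exact ⟨KTSPInstance.adKTSP_feasible hO hτ (by omega) hD hN,
      KTSPInstance.adKTSP_cost_le hk hI hρ hO hτ hα N⟩
  · intro V _ _ k I ρ O τ hk hI hρ hO hτ α hα D N hD hN
    have hα2 := two_le_of_iterBound_le hk hρ hα (by norm_num)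
    exact ⟨KTSPInstance.nonAdKTSP_feasible hk hO hτ (by omega) hD hN,
      KTSPInstance.nonAdKTSP_cost_le hk hI hρ hO hτ hα N⟩
  · intro V _ _ k I ρ O τ hk hI hρ hO hτ D _
    have hlog : 0 ≤ Real.log k := Real.log_natCast_nonneg k
    refine ⟨fun N _ => ?_, fun N _ => ?_⟩
    · refine (KTSPInstance.adKTSP_cost_le hk hI hρ hO hτ (Nat.le_ceil _) N).trans
        (mul_le_mul_left ?_ _)
      rw [← ENNReal.ofReal_natCast, ← ENNReal.ofReal_ofNat 8,
        ← ENNReal.ofReal_mul (by norm_num)]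
      refine ENNReal.ofReal_le_ofReal ?_
      -- This gives 8·(2·4 + 1) = 72. The constant 272 = 8·17·2 comes from NonAd-kTSP.
      have h1 := natCeil_iterBound_le (c := 4) (k := k) hρ (by norm_num)
      have h2 : 0 ≤ ρ * (1 + Real.log k) := by positivity
      linarith
    · refine (KTSPInstance.nonAdKTSP_cost_le hk hI hρ hO hτ (Nat.le_ceil _) N).trans
        (mul_le_mul_left ?_ _)
      rw [← ENNReal.ofReal_natCast, ← ENNReal.ofReal_natCast (1 + Nat.log 2 k),
        ← ENNReal.ofReal_ofNat 8, ← ENNReal.ofReal_mul (by norm_num),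
        ← ENNReal.ofReal_mul (by positivity)]
      exact ENNReal.ofReal_le_ofReal (KTSPInstance.eight_mul_natCeil_mul_le hk hρ)
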